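/- Let $D$ be an integral domain with quotient field $K$, and let $\Gamma$ be a nonzero torsion-free monoid (a commutative cancellative additive semigroup with identity, $\Gamma \neq \{0\}$, such that $n\alpha = n\beta$ with $n \geq 1$ implies $\alpha=\beta$) with quotient group $G$. Then the semigroup ring $D[\Gamma]$ is a weakly Krull domain if and only if $D$ is a weakly Krull UMT-domain, $\Gamma$ is a weakly Krull UMT-monoid, and the group ring $K[G]$ is a weakly Krull domain. Here the notions are as follows. - An integral domain $A$ with quotient field $F$ is a weakly Krull domain if $A = \bigcap_{P} A_P$ (inside $F$), where $P$ runs over the height-one prime ideals of $A$ (the empty intersection being $F$), and each nonzero nonunit of $A$ lies in only finitely many height-one prime ideals. - For a nonzero fractional ideal $I$ of $A$ put $I^{-1} = \{x \in F \mid xI \subseteq A\}$, $I_v = (I^{-1})^{-1}$, and $I_t = \bigcup J_v$, where $J$ runs over the nonzero finitely generated fractional ideals contained in $I$; $I$ is a $t$-ideal if $I_t = I$, and a maximal $t$-ideal is a maximal element of the set of proper integral $t$-ideals. $A$ is a UMT-domain if each nonzero prime ideal $Q$ of the polynomial ring $A[X]$ with $Q \cap A = (0)$ is a maximal $t$-ideal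 of $A[X]$. - An ideal of $\Gamma$ is a subset $S$ with $S + \Gamma \subseteq S$; it is prime if $S \neq \Gamma$ and $a+b \in S$ implies $a \in S$ or $b \in S$; it is a height-one prime if it is minimal among the nonempty prime ideals. For a submonoid $T$ of $G$ containing $\Gamma$ and a prime ideal $S$ of $\Gamma$ put $T_S = \{x - s \mid x \in T,\ s \in \Gamma \setminus S\} \subseteq G$. $\Gamma$ is a weakly Krull monoid if $\Gamma = \bigcap_S \Gamma_S$ (inside $G$), where $S$ runs over the height-one primes of $\Gamma$ (the empty intersection being $G$), and each nonunit of $\Gamma$ lies in only finitely many height-one primes. - For nonempty $I \subseteq G$ with $I + \Gamma \subseteq I$ put $I^{-1} = \{g \in G \mid g + I \subseteq \Gamma\}$, $I_v = (I^{-1})^{-1}$, and $I_t = \bigcup J_v$, where $J$ runs over the sets $E + \Gamma \subseteq I$ with $E \subseteq G$ finite and nonempty. A maximal $t$-ideal of $\Gamma$ is a maximal element of the set of nonempty proper ideals $S \subsetneq \Gamma$ with $S_t = S$. Let $\bar\Gamma = \{g \in G \mid ng \in \Gamma \text{ for some } n \geq 1\}$. $\Gamma$ is a UMT-monoid if for every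 maximal $t$-ideal $S$ of $\Gamma$ the monoid $\bar\Gamma_S$ is a valuation monoid, i.e. for all $a, b \in \bar\Gamma_S$ one has $b - a \in \bar\Gamma_S$ or $a - b \in \bar\Gamma_S$. -/

import Mathlib

open scoped Pointwise nonZeroDivisors

namespace WeaklyKrull

/-! ### Integral domains -/

section Domain

/-- `A` is a weakly Krull domain: `A` is an integral domain, `A` is the intersection (in its
quotient field) of the localizations `A_P` at the height-one primes `P`, and each nonzero nonunit
lies in only finitely many height-one primes. The intersection over the empty family is the whole
quotient field, so a field is a weakly Krull domain. -/
class IsWeaklyKrullDomain (A : Type*) [CommRing A] : Prop extends IsDomain A where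
  iInf_localization_eq_bot :
    ⨅ P : {P : PrimeSpectrum A // P.asIdeal.height = 1},
      Localization.subalgebra.ofField (FractionRing A) P.1.asIdeal.primeCompl
        P.1.asIdeal.primeCompl_le_nonZeroDivisors = ⊥
  finite_height_one : ∀ a : A, a ≠ 0 → ¬ IsUnit a →
    {P : Ideal A | P.IsPrime ∧ P.height = 1 ∧ a ∈ P}.Finite

variable {A : Type*} [CommRing A] [IsDomain A]

/-- `I_v = (I⁻¹)⁻¹`, for a fractional ideal `I` of the domain `A`. -/
noncomputable def vClosure (I : FractionalIdeal A⁰ (FractionRing A)) :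
    FractionalIdeal A⁰ (FractionRing A) :=
  (I⁻¹)⁻¹

/-- `I_t` is the union of the `J_v` over the nonzero finitely generated fractional ideals `J`
contained in `I`. -/
def tClosure (I : FractionalIdeal A⁰ (FractionRing A)) : Set (FractionRing A) :=
  {x | ∃ J : FractionalIdeal A⁰ (FractionRing A),
    J ≠ 0 ∧ (J : Submodule A (FractionRing A)).FG ∧ J ≤ I ∧ x ∈ vClosure J}

/-- A `t`-ideal is a nonzero fractional ideal `I` with `I_t = I`. -/
def IsTIdeal (I : FractionalIdeal A⁰ (FractionRing A)) : Prop :=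
  I ≠ 0 ∧ tClosure I = {x | x ∈ I}

/-- A maximal `t`-ideal is a maximal element among the proper integral `t`-ideals. -/
def IsMaximalTIdeal (P : Ideal A) : Prop :=
  Maximal (fun I : Ideal A ↦ I ≠ ⊤ ∧ IsTIdeal (I : FractionalIdeal A⁰ (FractionRing A))) P

variable (A) in
/-- `A` is a UMT-domain: each upper to zero in `A[X]`, i.e. each nonzero prime ideal `Q` of `A[X]`
with `Q ∩ A = 0`, is a maximal `t`-ideal of `A[X]`. -/
def IsUMTDomain : Prop :=
  ∀ Q : Ideal (Polynomial A), Q.IsPrime → Q ≠ ⊥ → Q.comap Polynomial.C = ⊥ → IsMaximalTIdeal Q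

end Domain

/-! ### Commutative cancellative monoids, written additively -/

section Monoid

variable {Γ : Type*} [AddCommMonoid Γ]

open Algebra (GrothendieckAddGroup)

variable (Γ) in
/-- The image of `Γ` in its quotient group. -/
def base : AddSubmonoid (GrothendieckAddGroup Γ) :=
  AddMonoidHom.mrange (GrothendieckAddGroup.of (M := Γ))

/-- A prime ideal of `Γ`: a proper ideal `S` such that `a + b ∈ S` implies `a ∈ S` or `b ∈ S`.
The empty ideal is prime. -/
def IsPrimeIdeal (S : AddSemigroupIdeal Γ) : Prop :=
  (S : Set Γ) ≠ Set.univ ∧ ∀ a b : Γ, a + b ∈ S → a ∈ S ∨ b ∈ S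

/-- A height-one prime ideal of `Γ`: a minimal nonempty prime ideal. -/
def IsHeightOnePrime (S : AddSemigroupIdeal Γ) : Prop :=
  Minimal (fun I : AddSemigroupIdeal Γ ↦ IsPrimeIdeal I ∧ (I : Set Γ).Nonempty) S

/-- `T_S = {x - s | x ∈ T, s ∈ Γ \ S}`: the localization, inside the quotient group, of a
submonoid `T` containing `Γ` at a prime ideal `S` of `Γ`. -/
def localizationAt (T : AddSubmonoid (GrothendieckAddGroup Γ)) (S : AddSemigroupIdeal Γ) :
    Set (GrothendieckAddGroup Γ) :=
  {g | ∃ x ∈ T, ∃ s : Γ, s ∉ S ∧ g = x - GrothendieckAddGroup.of s}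

variable (Γ) in
/-- `Γ` is a weakly Krull monoid: `Γ` is the intersection (in its quotient group) of the
localizations `Γ_S` at the height-one primes `S`, and each nonunit of `Γ` lies in only finitely
many height-one primes. -/
structure IsWeaklyKrullMonoid : Prop where
  iInter_localization_eq :
    ⋂ S : {S : AddSemigroupIdeal Γ // IsHeightOnePrime S}, localizationAt (base Γ) S.1 = base Γ
  finite_height_one : ∀ a : Γ, ¬ IsAddUnit a →
    {S : AddSemigroupIdeal Γ | IsHeightOnePrime S ∧ a ∈ S}.Finite

/-- `I⁻¹ = {g | g + I ⊆ Γ}`, in the quotient group of `Γ`. -/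
def monoidInv (I : Set (GrothendieckAddGroup Γ)) : Set (GrothendieckAddGroup Γ) :=
  {g | ∀ x ∈ I, g + x ∈ base Γ}

/-- `I_v = (I⁻¹)⁻¹`. -/
def monoidVClosure (I : Set (GrothendieckAddGroup Γ)) : Set (GrothendieckAddGroup Γ) :=
  monoidInv (monoidInv I)

/-- `I_t` is the union of the `J_v` over the nonempty finitely generated fractional ideals
`J = E + Γ` (with `E` finite) contained in `I`. -/
def monoidTClosure (I : Set (GrothendieckAddGroup Γ)) : Set (GrothendieckAddGroup Γ) :=
  {g | ∃ E : Set (GrothendieckAddGroup Γ), E.Finite ∧ E.Nonempty ∧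
    E + (base Γ : Set (GrothendieckAddGroup Γ)) ⊆ I ∧
    g ∈ monoidVClosure (E + (base Γ : Set (GrothendieckAddGroup Γ)))}

/-- A (nonempty, integral) `t`-ideal of `Γ`. -/
def IsMonoidTIdeal (S : AddSemigroupIdeal Γ) : Prop :=
  (S : Set Γ).Nonempty ∧
    monoidTClosure (GrothendieckAddGroup.of '' (S : Set Γ)) =
      GrothendieckAddGroup.of '' (S : Set Γ)

/-- A maximal `t`-ideal of `Γ`: a maximal element among the proper `t`-ideals of `Γ`. -/
def IsMaximalMonoidTIdeal (S : AddSemigroupIdeal Γ) : Prop :=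
  Maximal (fun I : AddSemigroupIdeal Γ ↦ (I : Set Γ) ≠ Set.univ ∧ IsMonoidTIdeal I) S

variable (Γ) in
/-- The integral closure (root closure) `{g | n • g ∈ Γ for some n ≥ 1}` of `Γ` in its quotient
group. -/
def rootClosure : AddSubmonoid (GrothendieckAddGroup Γ) where
  carrier := {g | ∃ n : ℕ, 1 ≤ n ∧ n • g ∈ base Γ}
  zero_mem' := ⟨1, le_rfl, by simp⟩
  add_mem' := by
    rintro a b ⟨m, hm, ha⟩ ⟨n, hn, hb⟩
    refine ⟨m * n, Nat.mul_pos hm hn, ?_⟩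
    rw [smul_add, mul_comm m n, mul_smul, mul_comm n m, mul_smul]
    exact add_mem (nsmul_mem ha n) (nsmul_mem hb m)

/-- Of any two elements of the (sub)monoid `V`, one divides the other in `V`. -/
def IsValuationMonoid (V : Set (GrothendieckAddGroup Γ)) : Prop :=
  ∀ a ∈ V, ∀ b ∈ V, (∃ c ∈ V, b = a + c) ∨ (∃ c ∈ V, a = b + c)

variable (Γ) in
/-- `Γ` is a UMT-monoid: the localization at `S` of the root closure of `Γ` is a valuation monoid
for every maximal `t`-ideal `S` of `Γ`. -/
def IsUMTMonoid : Prop :=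
  ∀ S : AddSemigroupIdeal Γ, IsMaximalMonoidTIdeal S →
    IsValuationMonoid (localizationAt (rootClosure Γ) S)

end Monoid

end WeaklyKrull

/-!
# Weakly Krull semigroup rings

Write `R = D[Γ]`, and let `P[Γ]` and `D[S]` denote the ideals of `R` consisting of the elements with
coefficients in the prime `P` of `D`, respectively with exponents in the prime `S` of `Γ`. They are
prime because `Γ` is torsion-free.

The equality of a domain `A` with the intersection of its localizations at the height-one primes
says that `a ∣ b` as soon as `a` divides `b` locally at each of these primes
(`isWeaklyKrullDomain_iff`). A prime `U` containing `a` is minimal over `a` if each `f ∈ U`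
satisfies `a ∣ s * f ^ m` for some `s ∉ U` (`IsMinimalOver`). In a weakly Krull domain, such a `U`
has height one, by prime avoidance (`IsMinimalOver.isHeightOne`). If `P` is minimal over `a`, then
`P[Γ]` is minimal over the constant `a`; if `S` is minimal over `α`, then `D[S]` is minimal over
`X ^ α`.

*Ascent.* The ring `K[G]` is the localization of `R` at the monomials, so each height-one prime of
`R` is contracted from `K[G]`, or of the form `P[Γ]`, or of the form `D[S]`. Conversely `P[Γ]` and
`D[S]` do have height one under the UMT conditions. For `P[Γ]`, suppose that `Q < P[Γ]` is a nonzero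
prime; it contains no nonzero constant. Let `E` be the integral closure of `D` in `K`. By going up
along the integral extension `R ⊆ E[Γ]`, the prime `Q` lies under a prime contained in some `M[Γ]`
with `M` over `P`. Over a weakly Krull domain, the UMT condition says that no upper to zero is
contained in an extended prime `P[X]` (`isUMTDomain_iff`), so each element of `K` is a root of a
polynomial with a coefficient outside `P`, and by the `u`, `u⁻¹` lemma `E_M` is a valuation ring.
Dividing an element of `Q` by its coefficient of least value gives a contradiction. For `D[S]` the
argument is the same, with the root closure of `Γ` in the place of `E`. Once the height-one primes
are known, finiteness is immediate; a fraction that is locally integral lies in `K[G]`, so its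
denominator is a monomial, and a monomial is tested coefficientwise because `P[Γ]` and `D[S]` admit
primary components generated by monomials.

*Descent.* If `R` is weakly Krull, then all `P[Γ]` and `D[S]` have height one, being minimal over a
monomial. The weak Krull property passes to `D` and `Γ` by testing divisibility of monomials, and to
`K[G]` because it is a localization. As `P[Γ]` has height one, it is minimal over each of its
nonzero elements. Applied to the elements of `P[Γ]` obtained from polynomials by `X ↦ X ^ γ`, this
shows that no upper to zero of `D[X]` lies in `P[X]`, after a restriction to a coset of `ℤγ`.
Applied to binomials `X ^ α - X ^ β` in `D[S]`, it gives an element `σ ∉ D[S]` which vanishes in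
`D[G / ℤ(α - β)]`; two exponents of `σ` then differ by a multiple of `α - β`, and this puts `α - β`
or its negative into the localization of the root closure at `S`.
-/

namespace WeaklyKrull

/-! ### Height-one primes and weakly Krull domains -/

section Domain

variable {A : Type*} [CommRing A]

/-- A height-one prime ideal of a domain, described as a minimal nonzero prime ideal. -/
def IsHeightOne (P : Ideal A) : Prop :=
  Minimal (fun Q : Ideal A ↦ Q.IsPrime ∧ Q ≠ ⊥) P

lemma IsHeightOne.isPrime {P : Ideal A} (hP : IsHeightOne P) : P.IsPrime := hP.prop.1

lemma IsHeightOne.ne_bot {P : Ideal A} (hP : IsHeightOne P) : P ≠ ⊥ := hP.prop.2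

lemma IsHeightOne.eq_of_le {P Q : Ideal A} (hP : IsHeightOne P) (hQ : Q.IsPrime) (hQ0 : Q ≠ ⊥)
    (h : Q ≤ P) : Q = P :=
  (hP.eq_of_ge ⟨hQ, hQ0⟩ h).symm

lemma IsHeightOne.exists_ne_zero {P : Ideal A} (hP : IsHeightOne P) : ∃ a ∈ P, a ≠ 0 :=
  Submodule.exists_mem_ne_zero_of_ne_bot hP.ne_bot

lemma isPrime_and_height_eq_one_iff [IsDomain A] {P : Ideal A} :
    P.IsPrime ∧ P.height = 1 ↔ IsHeightOne P := by
  constructor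
  · rintro ⟨hP, h⟩
    refine ⟨⟨hP, fun h0 ↦ by simp [h0] at h⟩, fun Q hQ hle ↦ ?_⟩
    by_contra hn
    have hlt : Q < P := lt_of_le_not_ge hle hn
    have := (Ideal.height_le_iff (n := 1)).1 (by simp [h]) Q hQ.1 hlt
    exact hQ.2 (Ideal.height_eq_zero_iff_eq_bot.1 (by simpa using this))
  · intro hP
    have := hP.isPrime
    refine ⟨hP.isPrime, le_antisymm ?_ ?_⟩
    · refine (Ideal.height_le_iff (n := 1)).2 fun Q hQ hlt ↦ ?_
      have : Q = ⊥ := by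
        by_contra h0
        exact hlt.ne (hP.eq_of_le hQ h0 hlt.le)
      simp [this]
    · rw [Order.one_le_iff_ne_zero, Ne, Ideal.height_eq_zero_iff_eq_bot]
      exact hP.ne_bot

/-- The prime `U` is minimal over the principal ideal of `a ≠ 0`, in elementary terms. -/
def IsMinimalOver (a : A) (U : Ideal A) : Prop :=
  a ≠ 0 ∧ a ∈ U ∧ ∀ f ∈ U, ∃ s ∉ U, ∃ m : ℕ, a ∣ s * f ^ m

lemma IsHeightOne.isMinimalOver {P : Ideal A} (hP : IsHeightOne P) {a : A} (ha : a ∈ P)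
    (ha0 : a ≠ 0) : IsMinimalOver a P := by
  refine ⟨ha0, ha, fun f hf ↦ ?_⟩
  have := hP.isPrime
  by_contra! hcon
  -- A prime containing `a` and avoiding all `s * f ^ m` would lie strictly below `P`.
  obtain ⟨Q, hQ, haQ, hdis⟩ := Ideal.exists_le_prime_disjoint (Ideal.span {a})
    (P.primeCompl ⊔ Submonoid.powers f) (by
      rw [Set.disjoint_left]
      rintro x hx hx'
      obtain ⟨s, hs, _, ⟨m, rfl⟩, rfl⟩ := Submonoid.mem_sup.1 hx'
      exact hcon s hs m (Ideal.mem_span_singleton.1 hx))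
  rw [Set.disjoint_left] at hdis
  have hQP : Q ≤ P := by
    intro x hx
    by_contra hxP
    exact hdis hx (Submonoid.mem_sup_left (S := P.primeCompl) hxP)
  have haQ' : a ∈ Q := haQ (Ideal.mem_span_singleton_self a)
  have := hP.eq_of_le hQ (fun h ↦ ha0 (by simpa [h] using haQ')) hQP
  exact hdis (this ▸ hf) (Submonoid.mem_sup_right (Submonoid.mem_powers f))

lemma comap_injective_of_isLocalization (N : Submonoid A) (B : Type*) [CommRing B]
    [Algebra A B] [IsLocalization N B] :
    Function.Injective (Ideal.comap (algebraMap A B) : Ideal B → Ideal A) :=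
  Function.LeftInverse.injective (IsLocalization.map_under N B)

variable [IsDomain A]

/-- Membership in the intersection of the localizations at the height-one primes, tested on a
fraction `b / a`, amounts to the local divisibilities `a ∣ s * b`. -/
theorem isWeaklyKrullDomain_iff : IsWeaklyKrullDomain A ↔
    (∀ a b : A, a ≠ 0 → (∀ P : Ideal A, IsHeightOne P → ∃ s ∉ P, a ∣ s * b) → a ∣ b) ∧
      ∀ a : A, a ≠ 0 → {P : Ideal A | IsHeightOne P ∧ a ∈ P}.Finite := by
  have key : ∀ (P : PrimeSpectrum A) (a b : A), a ≠ 0 →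
      (algebraMap A (FractionRing A) b / algebraMap A (FractionRing A) a ∈
        Localization.subalgebra.ofField (FractionRing A) P.asIdeal.primeCompl
        P.asIdeal.primeCompl_le_nonZeroDivisors ↔ ∃ s ∉ P.asIdeal, a ∣ s * b) := by
    intro P a b ha
    have ha' : algebraMap A (FractionRing A) a ≠ 0 := by simpa using ha
    change (∃ (c s : A) (_ : s ∈ P.asIdeal.primeCompl), algebraMap A (FractionRing A) b /
      algebraMap A (FractionRing A) a = algebraMap A (FractionRing A) c *
        (algebraMap A (FractionRing A) s)⁻¹) ↔ _
    constructor
    · rintro ⟨c, s, hs, h⟩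
      have hs0 : algebraMap A (FractionRing A) s ≠ 0 := by
        simpa using fun h0 : s = 0 ↦ hs (h0 ▸ zero_mem _)
      refine ⟨s, hs, c, ?_⟩
      apply IsFractionRing.injective A (FractionRing A)
      rw [div_eq_iff ha'] at h
      rw [map_mul, map_mul, h]
      field_simp
    · rintro ⟨s, hs, c, h⟩
      have hs0 : algebraMap A (FractionRing A) s ≠ 0 := by
        simpa using fun h0 : s = 0 ↦ hs (h0 ▸ zero_mem _)
      refine ⟨c, s, hs, ?_⟩
      have := congrArg (algebraMap A (FractionRing A)) h
      rw [map_mul, map_mul] at this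
      field_simp
      linear_combination this
  constructor
  · intro h
    constructor
    · intro a b ha hab
      have ha' : algebraMap A (FractionRing A) a ≠ 0 := by simpa using ha
      have hmem : algebraMap A (FractionRing A) b / algebraMap A (FractionRing A) a ∈
          (⊥ : Subalgebra A (FractionRing A)) := by
        rw [← h.iInf_localization_eq_bot, Algebra.mem_iInf]
        intro P
        exact (key P.1 a b ha).2 (hab _ (isPrime_and_height_eq_one_iff.1 ⟨P.1.2, P.2⟩))
      obtain ⟨c, hc⟩ := Algebra.mem_bot.1 hmem
      refine ⟨c, IsFractionRing.injective A (FractionRing A) ?_⟩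
      rw [map_mul, hc]
      field_simp
    · intro a ha
      by_cases hu : IsUnit a
      · convert Set.finite_empty
        ext P
        simp only [Set.mem_ofPred_eq, Set.mem_empty_iff_false, iff_false, not_and]
        exact fun hP hmem ↦ hP.isPrime.ne_top (Ideal.eq_top_of_isUnit_mem _ hmem hu)
      · convert h.finite_height_one a ha hu using 3 with P
        rw [← isPrime_and_height_eq_one_iff, and_assoc]
  · rintro ⟨h1, h2⟩
    refine { iInf_localization_eq_bot := ?_, finite_height_one := ?_ }
    · rw [eq_bot_iff]
      intro x hx
      obtain ⟨b, a, ha, rfl⟩ := IsFractionRing.div_surjective (A := A) x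
      have ha0 : a ≠ 0 := nonZeroDivisors.ne_zero ha
      obtain ⟨c, rfl⟩ := h1 a b ha0 fun P hP ↦ by
        have hP' := isPrime_and_height_eq_one_iff.2 hP
        rw [Algebra.mem_iInf] at hx
        exact (key ⟨P, hP'.1⟩ a b ha0).1 (hx ⟨⟨P, hP'.1⟩, hP'.2⟩)
      have ha' : algebraMap A (FractionRing A) a ≠ 0 := by simpa using ha0
      refine Algebra.mem_bot.2 ⟨c, ?_⟩
      rw [map_mul]
      field_simp
    · intro a ha _
      convert h2 a ha using 3 with P
      rw [← isPrime_and_height_eq_one_iff, and_assoc]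

/-- In a weakly Krull domain, a prime minimal over a nonzero principal ideal has height one: by
prime avoidance it lies in one of the finitely many height-one primes containing the generator. -/
lemma IsMinimalOver.isHeightOne (hA : IsWeaklyKrullDomain A) {a : A} {U : Ideal A}
    (hU : U.IsPrime) (h : IsMinimalOver a U) : IsHeightOne U := by
  obtain ⟨h1, h2⟩ := isWeaklyKrullDomain_iff.1 hA
  obtain ⟨ha0, haU, hmin⟩ := h
  have hU0 : U ≠ ⊥ := fun h ↦ ha0 (by simpa [h] using haU)
  suffices H : ∃ P ∈ {P : Ideal A | IsHeightOne P ∧ a ∈ P}, U ≤ P by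
    obtain ⟨P, hP, hle⟩ := H
    exact hP.1.eq_of_le hU hU0 hle ▸ hP.1
  refine (Ideal.subset_union_prime_finite (h2 a ha0) (f := id) ⊥ ⊥
    fun P hP _ _ ↦ hP.1.isPrime).1 ?_
  intro f hf
  by_contra hfP
  simp only [Set.mem_ofPred_eq, id_eq, Set.mem_iUnion, SetLike.mem_coe, not_exists] at hfP
  obtain ⟨s, hs, m, hdvd⟩ := hmin f hf
  refine hs (U.mem_of_dvd (h1 a s ha0 fun P hP ↦ ?_) haU)
  by_cases haP : a ∈ P
  · exact ⟨f ^ m, fun hm ↦ hfP P ⟨hP, haP⟩ (hP.isPrime.mem_of_pow_mem m hm), by rwa [mul_comm]⟩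
  · exact ⟨a, haP, dvd_mul_right _ _⟩

lemma IsHeightOne.comap_of_isLocalization (N : Submonoid A) {B : Type*} [CommRing B] [IsDomain B]
    [Algebra A B] [IsLocalization N B] {Q : Ideal B} (hQ : IsHeightOne Q) :
    IsHeightOne (Q.comap (algebraMap A B)) := by
  have := hQ.isPrime
  refine isPrime_and_height_eq_one_iff.1 ⟨Ideal.comap_isPrime _ _, ?_⟩
  change (Q.under A).height = 1
  rw [IsLocalization.height_under N]
  exact (isPrime_and_height_eq_one_iff.2 hQ).2

lemma IsHeightOne.map_of_isLocalization {P : Ideal A} (hP : IsHeightOne P) (N : Submonoid A)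
    (B : Type*) [CommRing B] [IsDomain B] [Algebra A B] [IsLocalization N B]
    (hd : Disjoint (N : Set A) P) : IsHeightOne (P.map (algebraMap A B)) ∧
      (P.map (algebraMap A B)).comap (algebraMap A B) = P := by
  have := hP.isPrime
  have hc : (P.map (algebraMap A B)).comap (algebraMap A B) = P :=
    IsLocalization.under_map_of_isPrime_disjoint N B hP.isPrime hd
  refine ⟨isPrime_and_height_eq_one_iff.1
    ⟨IsLocalization.isPrime_of_isPrime_disjoint N B P hP.isPrime hd, ?_⟩, hc⟩
  rw [← IsLocalization.height_under N]
  change (Ideal.comap _ _).height = 1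
  rw [hc]
  exact (isPrime_and_height_eq_one_iff.2 hP).2

/-- Localizations of weakly Krull domains are weakly Krull. -/
lemma IsWeaklyKrullDomain.of_isLocalization (hA : IsWeaklyKrullDomain A) (N : Submonoid A)
    (hN : N ≤ A⁰) (B : Type*) [CommRing B] [IsDomain B] [Algebra A B] [IsLocalization N B] :
    IsWeaklyKrullDomain B := by
  obtain ⟨h1, h2⟩ := isWeaklyKrullDomain_iff.1 hA
  have hinj : Function.Injective (algebraMap A B) := IsLocalization.injective B hN
  have hunit : ∀ n ∈ N, IsUnit (algebraMap A B n) := fun n hn ↦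
    IsLocalization.map_units B ⟨n, hn⟩
  rw [isWeaklyKrullDomain_iff]
  constructor
  · intro x y hx hxy
    obtain ⟨⟨a, n⟩, ha⟩ := IsLocalization.surj N x
    obtain ⟨⟨b, k⟩, hb⟩ := IsLocalization.surj N y
    have ha0 : a ≠ 0 := by
      rintro rfl
      simp only [map_zero, mul_eq_zero, hx, false_or] at ha
      exact (hunit n n.2).ne_zero ha
    have hx_dvd : ∀ z, x ∣ z ↔ algebraMap A B a ∣ z := fun z ↦ by
      rw [← ha, (hunit n n.2).mul_right_dvd]
    rw [hx_dvd, ← (hunit k k.2).dvd_mul_right, hb]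
    -- A single multiplier `n ∈ N` clears all height-one primes which meet `N` and contain `a`.
    have hfin := h2 a ha0
    have hex : ∀ P ∈ hfin.toFinset, ∃ n ∈ N, Disjoint (N : Set A) P ∨ ∃ s ∉ P, a ∣ s * n := by
      intro P hP
      rw [Set.Finite.mem_toFinset] at hP
      by_cases hd : Disjoint (N : Set A) P
      · exact ⟨1, one_mem _, .inl hd⟩
      · obtain ⟨n, hn, hnP⟩ := Set.not_disjoint_iff.1 hd
        obtain ⟨s, hs, m, h⟩ := (hP.1.isMinimalOver hP.2 ha0).2.2 n hnP
        exact ⟨n ^ m, pow_mem hn m, .inr ⟨s, hs, h⟩⟩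
    choose! ν hν hν' using hex
    have hn : ∏ P ∈ hfin.toFinset, ν P ∈ N := Submonoid.prod_mem _ hν
    suffices H : a ∣ (∏ P ∈ hfin.toFinset, ν P) * b by
      obtain ⟨c, hc⟩ := H
      rw [← (hunit _ hn).dvd_mul_left]
      exact ⟨algebraMap A B c, by rw [← map_mul, hc, map_mul]⟩
    refine h1 a _ ha0 fun P hP ↦ ?_
    by_cases haP : a ∈ P
    swap
    · exact ⟨a, haP, dvd_mul_right _ _⟩
    have hPf : P ∈ hfin.toFinset := by simp [hP, haP]
    obtain hd | ⟨s, hs, h⟩ := hν' P hPf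
    · obtain ⟨hQ, hc⟩ := hP.map_of_isLocalization N B hd
      obtain ⟨t, ht, z, hz⟩ := hxy _ hQ
      obtain ⟨⟨t', l⟩, htl⟩ := IsLocalization.surj N t
      have htP : t' ∉ P := by
        rw [← hc, Ideal.mem_comap, ← htl]
        exact fun hm ↦ ht ((Ideal.mul_unit_mem_iff_mem _ (hunit l l.2)).1 hm)
      have hdvd : algebraMap A B a ∣ algebraMap A B (t' * b) := by
        rw [map_mul, ← htl, ← hb, ← hx_dvd]
        exact ⟨z * algebraMap A B l * algebraMap A B k, by
          linear_combination (algebraMap A B l * algebraMap A B k) * hz⟩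
      obtain ⟨w, hw⟩ := hdvd
      obtain ⟨⟨w', j⟩, hwj⟩ := IsLocalization.surj N w
      refine ⟨j * t', fun hm ↦ ?_, w' * ∏ P ∈ hfin.toFinset, ν P, ?_⟩
      · rcases hP.isPrime.mem_or_mem hm with hm | hm
        · exact Set.disjoint_left.1 hd j.2 hm
        · exact htP hm
      · have : j * t' * b = a * w' := hinj (by
          simp only [map_mul] at hw hwj ⊢
          linear_combination algebraMap A B j * hw + algebraMap A B a * hwj)
        linear_combination (∏ P ∈ hfin.toFinset, ν P) * this
    · refine ⟨s, hs, ?_⟩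
      rw [← mul_assoc]
      exact ((h.trans (mul_dvd_mul_left s (Finset.dvd_prod_of_mem ν hPf))).mul_right b)
  · intro x hx
    obtain ⟨⟨a, n⟩, ha⟩ := IsLocalization.surj N x
    have ha0 : a ≠ 0 := by
      rintro rfl
      simp only [map_zero, mul_eq_zero, hx, false_or] at ha
      exact (hunit n n.2).ne_zero ha
    refine Set.Finite.of_finite_image ((h2 a ha0).subset ?_)
      (f := Ideal.comap (algebraMap A B)) ?_
    · rintro _ ⟨Q, hQ, rfl⟩
      refine ⟨hQ.1.comap_of_isLocalization N, ?_⟩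
      rw [Ideal.mem_comap, ← ha]
      exact Ideal.mul_mem_right _ _ hQ.2
    · exact (comap_injective_of_isLocalization N B).injOn

end Domain

/-! ### `t`-ideals of a domain -/

section TIdeal

variable {A : Type*} [CommRing A]

/-- The ideal `aA_U ∩ A` of the elements divisible by `a` locally at the prime `U`. -/
def locallyDivisibleIdeal (a : A) {U : Ideal A} (hU : U.IsPrime) : Ideal A where
  carrier := {f | ∃ s ∉ U, a ∣ s * f}
  add_mem' := by
    rintro f g ⟨s, hs, hf⟩ ⟨t, ht, hg⟩
    refine ⟨s * t, fun hm ↦ (hU.mem_or_mem hm).elim hs ht, ?_⟩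
    rw [mul_add]
    exact dvd_add ((hf.mul_left t).trans (dvd_of_eq (by ring)))
      ((hg.mul_left s).trans (dvd_of_eq (by ring)))
  zero_mem' := ⟨1, hU.one_notMem, by simp⟩
  smul_mem' := by
    rintro c f ⟨s, hs, hf⟩
    exact ⟨s, hs, (hf.mul_left c).trans (dvd_of_eq (by simp only [smul_eq_mul]; ring))⟩

lemma mem_locallyDivisibleIdeal {a : A} {U : Ideal A} {hU : U.IsPrime} {f : A} :
    f ∈ locallyDivisibleIdeal a hU ↔ ∃ s ∉ U, a ∣ s * f := Iff.rfl

variable [IsDomain A]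

lemma mem_vClosure_coeIdeal {J : Ideal A} (hJ : J ≠ ⊥) {y : FractionRing A} :
    y ∈ vClosure (J : FractionalIdeal A⁰ (FractionRing A)) ↔
      ∀ z : FractionRing A, (∀ j ∈ J, ∃ r : A, algebraMap A _ r = z * algebraMap A _ j) →
        ∃ r : A, algebraMap A _ r = z * y := by
  have hJ0 : (J : FractionalIdeal A⁰ (FractionRing A)) ≠ 0 := by simpa using hJ
  have hmem : ∀ z : FractionRing A, z ∈ (J : FractionalIdeal A⁰ (FractionRing A))⁻¹ ↔
      ∀ j ∈ J, ∃ r : A, algebraMap A _ r = z * algebraMap A _ j := by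
    intro z
    rw [FractionalIdeal.mem_inv_iff hJ0]
    constructor
    · intro h j hj
      obtain ⟨r, hr⟩ := (FractionalIdeal.mem_one_iff A⁰).1
        (h _ (FractionalIdeal.mem_coeIdeal_of_mem A⁰ hj))
      exact ⟨r, hr⟩
    · intro h y hy
      obtain ⟨j, hj, rfl⟩ := (FractionalIdeal.mem_coeIdeal A⁰).1 hy
      exact (FractionalIdeal.mem_one_iff A⁰).2 (h j hj)
  have hinv : (J : FractionalIdeal A⁰ (FractionRing A))⁻¹ ≠ 0 := by
    intro h0
    have : (1 : FractionRing A) ∈ (J : FractionalIdeal A⁰ (FractionRing A))⁻¹ :=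
      (hmem 1).2 fun j _ ↦ ⟨j, by simp⟩
    rw [h0, FractionalIdeal.mem_zero_iff] at this
    exact one_ne_zero this
  rw [vClosure, FractionalIdeal.mem_inv_iff hinv]
  refine forall_congr' fun z ↦ ?_
  rw [hmem, FractionalIdeal.mem_one_iff, mul_comm]

/-- An integral `t`-ideal is a nonzero ideal `I` such that `x ∈ I` whenever every fraction `c / a`
that multiplies some nonzero finitely generated `J ≤ I` into `A` also multiplies `x` into `A`. -/
theorem isTIdeal_coeIdeal_iff {I : Ideal A} :
    IsTIdeal (I : FractionalIdeal A⁰ (FractionRing A)) ↔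
      I ≠ ⊥ ∧ ∀ J : Ideal A, J.FG → J ≠ ⊥ → J ≤ I → ∀ x : A,
        (∀ c a : A, a ≠ 0 → (∀ j ∈ J, a ∣ c * j) → a ∣ c * x) → x ∈ I := by
  have hinj := IsFractionRing.injective A (FractionRing A)
  have hv : ∀ (J : Ideal A), J ≠ ⊥ → ∀ x : A,
      algebraMap A (FractionRing A) x ∈ vClosure (J : FractionalIdeal A⁰ (FractionRing A)) ↔
      (∀ c a : A, a ≠ 0 → (∀ j ∈ J, a ∣ c * j) → a ∣ c * x) := by
    intro J hJ x
    rw [mem_vClosure_coeIdeal hJ]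
    have hfrac : ∀ c a y : A, a ≠ 0 → ((∃ r : A, algebraMap A (FractionRing A) r =
        algebraMap A _ c / algebraMap A _ a * algebraMap A _ y) ↔ a ∣ c * y) := by
      intro c a y ha
      have ha' : algebraMap A (FractionRing A) a ≠ 0 := by simpa using ha
      refine exists_congr fun r ↦ ?_
      rw [← hinj.eq_iff, map_mul, map_mul]
      constructor
      · intro h
        rw [h]
        field_simp
      · intro h
        field_simp
        linear_combination -h
    constructor
    · intro h c a ha hj
      exact (hfrac c a x ha).1 (h _ fun j hjJ ↦ (hfrac c a j ha).2 (hj j hjJ))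
    · intro h z hz
      obtain ⟨c, a, ha, rfl⟩ := IsFractionRing.div_surjective (A := A) z
      have ha0 : a ≠ 0 := nonZeroDivisors.ne_zero ha
      exact (hfrac c a x ha0).2 (h c a ha0 fun j hj ↦ (hfrac c a j ha0).1 (hz j hj))
  constructor
  · rintro ⟨h0, h⟩
    refine ⟨by simpa using h0, fun J hfg hJ hle x hx ↦ ?_⟩
    have hxI : algebraMap A (FractionRing A) x ∈
        tClosure (I : FractionalIdeal A⁰ (FractionRing A)) := by
      refine ⟨(J : FractionalIdeal A⁰ (FractionRing A)), by simpa using hJ, ?_, ?_, ?_⟩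
      · exact (FractionalIdeal.coeIdeal_fg A⁰ hinj J).2 hfg
      · exact (FractionalIdeal.coeIdeal_le_coeIdeal _).2 hle
      · exact (hv J hJ x).2 hx
    rw [h] at hxI
    obtain ⟨x', hx', hxx'⟩ := (FractionalIdeal.mem_coeIdeal A⁰).1 hxI
    exact hinj hxx' ▸ hx'
  · rintro ⟨h0, h⟩
    refine ⟨by simpa using h0, Set.Subset.antisymm ?_ ?_⟩
    · rintro y ⟨J, hJ0, hfg, hle, hy⟩
      obtain ⟨J', rfl⟩ := FractionalIdeal.le_one_iff_exists_coeIdeal.1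
        (hle.trans FractionalIdeal.coeIdeal_le_one)
      have hJ' : J' ≠ ⊥ := by simpa using hJ0
      obtain ⟨x, hx⟩ := (mem_vClosure_coeIdeal hJ').1 hy 1 fun j _ ↦ ⟨j, by simp⟩
      rw [one_mul] at hx
      subst hx
      refine FractionalIdeal.mem_coeIdeal_of_mem A⁰ (h J' ?_ hJ' ?_ x ((hv J' hJ' x).1 hy))
      · exact (FractionalIdeal.coeIdeal_fg A⁰ hinj J').1 hfg
      · exact (FractionalIdeal.coeIdeal_le_coeIdeal _).1 hle
    · intro y hy
      obtain ⟨x, hx, rfl⟩ := (FractionalIdeal.mem_coeIdeal A⁰).1 hy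
      obtain ⟨i, hi, hi0⟩ := Submodule.exists_mem_ne_zero_of_ne_bot h0
      have hJ : Ideal.span {x, i} ≠ ⊥ := fun hb ↦ hi0 (by
        have : i ∈ Ideal.span {x, i} := Ideal.subset_span (by simp)
        simpa [hb] using this)
      refine ⟨(Ideal.span {x, i} : Ideal A), by simpa using hJ, ?_, ?_, ?_⟩
      · exact (FractionalIdeal.coeIdeal_fg A⁰ hinj _).2
          ((Submodule.fg_span (Set.toFinite _)))
      · refine (FractionalIdeal.coeIdeal_le_coeIdeal _).2 (Ideal.span_le.2 ?_)
        rintro z (rfl | rfl)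
        exacts [hx, hi]
      · exact (hv _ hJ x).2 fun c a _ hca ↦ hca x (Ideal.subset_span (by simp))

/-- A prime minimal over a nonzero principal ideal `(a)` is a `t`-ideal: for finitely generated
`J ≤ U` there is a power `J ^ n` with `s * J ^ n ⊆ (a)`, `s ∉ U`. An element `w` of the last power
whose multiples by elements outside `U` avoid `(a)` yields a fraction `s * w / a` that multiplies
`J`, but no element outside `U`, into `A`. -/
lemma IsMinimalOver.isTIdeal {a : A} {U : Ideal A} (hU : U.IsPrime) (h : IsMinimalOver a U) :
    IsTIdeal (U : FractionalIdeal A⁰ (FractionRing A)) := by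
  obtain ⟨ha0, haU, hmin⟩ := h
  rw [isTIdeal_coeIdeal_iff]
  refine ⟨fun hb ↦ ha0 (by simpa [hb] using haU), fun J hfg _ hle x hx ↦ ?_⟩
  obtain ⟨F, rfl⟩ := hfg
  let I : Ideal A := locallyDivisibleIdeal a hU
  have hrad : Ideal.span (F : Set A) ≤ I.radical := fun f hf ↦ by
    obtain ⟨s, hs, m, hm⟩ := hmin f (hle hf)
    exact ⟨m, s, hs, hm⟩
  obtain ⟨n, hn⟩ := Ideal.exists_pow_le_of_le_radical_of_fg hrad ⟨F, rfl⟩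
  have h1 : (1 : A) ∉ I := by
    rintro ⟨s, hs, hdvd⟩
    exact hs (U.mem_of_dvd (by simpa using hdvd) haU)
  have hex : ∃ n, Ideal.span (F : Set A) ^ n ≤ I := ⟨n, hn⟩
  classical
  obtain ⟨k, hk⟩ : ∃ k, Nat.find hex = k + 1 := by
    refine Nat.exists_eq_succ_of_ne_zero fun h0 ↦ h1 ?_
    have := Nat.find_spec hex
    rw [h0, pow_zero] at this
    exact this (by simp)
  have hk1 : Ideal.span (F : Set A) ^ (k + 1) ≤ I := hk ▸ Nat.find_spec hex
  obtain ⟨w, hw, hwI⟩ := SetLike.not_le_iff_exists.1 (Nat.find_min hex (m := k) (by omega))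
  have hwf : ∀ f ∈ Ideal.span (F : Set A), w * f ∈ I := fun f hf ↦
    hk1 (by rw [pow_succ]; exact Ideal.mul_mem_mul hw hf)
  have hs : ∀ f ∈ F, ∃ s ∉ U, a ∣ s * (w * f) := fun f hf ↦ hwf f (Ideal.subset_span hf)
  choose! s hsU hs using hs
  have hprod : ∏ f ∈ F, s f ∉ U := by
    rw [Ideal.IsPrime.prod_mem_iff (hp := hU)]
    push Not
    exact hsU
  by_contra hxU
  refine hwI ⟨(∏ f ∈ F, s f) * x, fun hm ↦ (hU.mem_or_mem hm).elim hprod hxU, ?_⟩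
  have := hx ((∏ f ∈ F, s f) * w) a ha0 (fun j hj ↦ by
    rw [← Ideal.mem_span_singleton]
    refine Submodule.span_induction (p := fun j _ ↦ (∏ f ∈ F, s f) * w * j ∈ Ideal.span {a})
      ?_ (by simp) ?_ ?_ hj
    · intro f hf
      rw [Ideal.mem_span_singleton, mul_assoc]
      exact (hs f hf).trans (mul_dvd_mul_right (Finset.dvd_prod_of_mem s hf) _)
    · intro f g _ _ hf hg
      rw [mul_add]
      exact add_mem hf hg
    · intro c f _ hf
      rw [smul_eq_mul, mul_left_comm]
      exact Ideal.mul_mem_left _ _ hf)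
  exact this.trans (dvd_of_eq (by ring))

end TIdeal

/-! ### Monomial ideals of a semigroup ring -/

lemma isAddTorsionFree_addSubmonoid {M : Type*} [AddCommMonoid M] [IsAddTorsionFree M]
    (N : AddSubmonoid M) : IsAddTorsionFree N :=
  ⟨fun _ hn _ _ h ↦ Subtype.ext (nsmul_right_injective hn (congrArg Subtype.val h))⟩

/-- Torsion-free cancellative commutative monoids have unique sums, since finitely many elements
generate a monoid which embeds into some `ℤⁿ`. -/
instance uniqueSums_of_isAddTorsionFree {M : Type*} [AddCommMonoid M] [IsCancelAdd M]
    [IsAddTorsionFree M] : UniqueSums M where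
  uniqueAdd_of_nonempty {A B} hA hB := by
    classical
    set N := AddSubmonoid.closure ((A ∪ B : Finset M) : Set M) with hN
    have := isAddTorsionFree_addSubmonoid N
    have : AddMonoid.FG N := inferInstanceAs (AddMonoid.FG (AddSubmonoid.closure _))
    let _ : AddCancelCommMonoid N :=
      { (inferInstance : AddCommMonoid N) with add_left_cancel := fun _ _ _ h ↦ add_left_cancel h }
    have hsub : ∀ x ∈ A ∪ B, x ∈ N := fun x hx ↦ AddSubmonoid.subset_closure hx
    obtain ⟨α, hα, β, hβ, h⟩ := UniqueSums.uniqueAdd_of_nonempty (G := N)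
      (A := A.attach.image fun x : {x // x ∈ A} ↦ (⟨x, hsub x (Finset.mem_union_left B x.2)⟩ : N))
      (B := B.attach.image fun x : {x // x ∈ B} ↦ (⟨x, hsub x (Finset.mem_union_right A x.2)⟩ : N))
      (by simpa using hA) (by simpa using hB)
    simp only [Finset.mem_image, Finset.mem_attach, true_and, Subtype.exists] at hα hβ
    obtain ⟨α, hα, rfl⟩ := hα
    obtain ⟨β, hβ, rfl⟩ := hβ
    refine ⟨α, hα, β, hβ, fun x y hx hy hxy ↦ ?_⟩
    have := h (a := ⟨x, hsub x (Finset.mem_union_left B hx)⟩)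
      (b := ⟨y, hsub y (Finset.mem_union_right A hy)⟩)
      (Finset.mem_image.2 ⟨⟨x, hx⟩, by simp, rfl⟩) (Finset.mem_image.2 ⟨⟨y, hy⟩, by simp, rfl⟩)
      (Subtype.ext hxy)
    exact ⟨congrArg Subtype.val this.1, congrArg Subtype.val this.2⟩

section MonomialIdeal

variable {D Γ : Type*} [CommRing D]

open AddMonoidAlgebra (single)

/-- The part of `f` consisting of the monomials satisfying a predicate on exponents. -/
noncomputable def filterExponents (p : Γ → Prop) (f : AddMonoidAlgebra D Γ) :
    AddMonoidAlgebra D Γ :=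
  open Classical in .ofCoeff (f.coeff.filter p)

lemma filterExponents_add_filterExponents_not (p : Γ → Prop) (f : AddMonoidAlgebra D Γ) :
    filterExponents p f + filterExponents (fun γ ↦ ¬ p γ) f = f := by
  classical
  ext γ
  simp [filterExponents, Finsupp.filter_apply]
  split_ifs <;> simp

lemma coeff_filterExponents_of_pos {p : Γ → Prop} {f : AddMonoidAlgebra D Γ} {γ : Γ} (h : p γ) :
    (filterExponents p f).coeff γ = f.coeff γ := by
  classical
  simp [filterExponents, h]

lemma coeff_filterExponents_of_neg {p : Γ → Prop} {f : AddMonoidAlgebra D Γ} {γ : Γ} (h : ¬ p γ) :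
    (filterExponents p f).coeff γ = 0 := by
  classical
  simp [filterExponents, h]

variable [AddCommMonoid Γ]

/-- The monomial ideal of `D[Γ]` with coefficient ideals `T γ`: all `f` whose coefficient at each
`γ` lies in `T γ`. -/
def monomialIdeal (T : Γ → Ideal D) (hT : ∀ γ δ, T δ ≤ T (γ + δ)) :
    Ideal (AddMonoidAlgebra D Γ) where
  carrier := {f | ∀ γ, f.coeff γ ∈ T γ}
  add_mem' hf hg γ := add_mem (hf γ) (hg γ)
  zero_mem' γ := by simp
  smul_mem' c f hf γ := by
    classical
    rw [smul_eq_mul, AddMonoidAlgebra.coeff_mul]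
    refine Ideal.sum_mem _ fun α _ ↦ Ideal.sum_mem _ fun β _ ↦ ?_
    dsimp only
    split_ifs with h
    · exact h ▸ Ideal.mul_mem_left _ _ (hT α β (hf β))
    · exact zero_mem _

variable {T U : Γ → Ideal D} {hT : ∀ γ δ, T δ ≤ T (γ + δ)} {hU : ∀ γ δ, U δ ≤ U (γ + δ)}

lemma single_mem_monomialIdeal {γ : Γ} {d : D} :
    single γ d ∈ monomialIdeal T hT ↔ d ∈ T γ := by
  classical
  refine ⟨fun h ↦ by simpa using h γ, fun h δ ↦ ?_⟩
  rw [AddMonoidAlgebra.coeff_single, Finsupp.single_apply]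
  split_ifs with hδ
  · exact hδ ▸ h
  · exact zero_mem _

/-- An ideal containing all monomials `f γ • X ^ γ` of `f` contains `f`. -/
lemma mem_of_forall_single_mem {I : Ideal (AddMonoidAlgebra D Γ)} {f : AddMonoidAlgebra D Γ}
    (h : ∀ γ, single γ (f.coeff γ) ∈ I) : f ∈ I := by
  rw [← AddMonoidAlgebra.sum_coeff_single f]
  exact Ideal.sum_mem _ fun γ _ ↦ h γ

variable [UniqueSums Γ]

/-- Multiplication by a nonzero `σ`, all of whose monomials are regular modulo a monomial ideal, is
injective modulo that ideal. -/
lemma mem_monomialIdeal_of_mul_mem_of_regular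
    (h2 : ∀ γ δ d e, d ∉ U γ → d * e ∈ T (γ + δ) → e ∈ T δ)
    {σ h : AddMonoidAlgebra D Γ} (hσ0 : σ ≠ 0) (hσ : ∀ γ ∈ σ.coeff.support, σ.coeff γ ∉ U γ)
    (hm : σ * h ∈ monomialIdeal T hT) : h ∈ monomialIdeal T hT := by
  set h₁ := filterExponents (fun γ ↦ h.coeff γ ∈ T γ) h with hh₁
  set h₂ := filterExponents (fun γ ↦ ¬ h.coeff γ ∈ T γ) h with hh₂
  have hsum : h₁ + h₂ = h := filterExponents_add_filterExponents_not _ h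
  have hmem₁ : h₁ ∈ monomialIdeal T hT := fun γ ↦ by
    by_cases hγ : h.coeff γ ∈ T γ
    · rwa [hh₁, coeff_filterExponents_of_pos (p := fun γ ↦ h.coeff γ ∈ T γ) hγ]
    · rw [hh₁, coeff_filterExponents_of_neg (p := fun γ ↦ h.coeff γ ∈ T γ) hγ]
      exact zero_mem _
  suffices hz : h₂ = 0 by rwa [← hsum, hz, add_zero]
  by_contra hne
  have hm₂ : σ * h₂ ∈ monomialIdeal T hT := by
    have : σ * h₂ = σ * h - σ * h₁ := by rw [← hsum]; ring
    rw [this]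
    exact sub_mem hm (Ideal.mul_mem_left _ _ hmem₁)
  obtain ⟨α, hα, β, hβ, huniq⟩ := UniqueSums.uniqueAdd_of_nonempty
    (A := σ.coeff.support) (B := h₂.coeff.support)
    (Finsupp.support_nonempty_iff.2 (by simpa using hσ0))
    (Finsupp.support_nonempty_iff.2 (by simpa using hne))
  have hαβ := hm₂ (α + β)
  rw [AddMonoidAlgebra.coeff_mul_add_of_uniqueAdd huniq] at hαβ
  have hβT := h2 α β _ _ (hσ α hα) hαβ
  rw [Finsupp.mem_support_iff] at hβ
  by_cases hp : h.coeff β ∈ T β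
  · exact hβ (coeff_filterExponents_of_neg (p := fun γ ↦ ¬ h.coeff γ ∈ T γ) (not_not.2 hp))
  · rw [hh₂, coeff_filterExponents_of_pos (p := fun γ ↦ ¬ h.coeff γ ∈ T γ) hp] at hβT
    exact hp hβT

/-- If a monomial ideal is primary on monomials, with radical `U`, then it is primary: `σ` splits
into a part with regular monomials and a part nilpotent modulo `T`. -/
theorem mem_monomialIdeal_of_mul_mem
    (h1 : ∀ γ, ∀ d ∈ U γ, ∃ n : ℕ, d ^ n ∈ T (n • γ))
    (h2 : ∀ γ δ d e, d ∉ U γ → d * e ∈ T (γ + δ) → e ∈ T δ)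
    {σ h : AddMonoidAlgebra D Γ} (hσ : σ ∉ monomialIdeal U hU)
    (hm : σ * h ∈ monomialIdeal T hT) : h ∈ monomialIdeal T hT := by
  set σ₁ := filterExponents (fun γ ↦ σ.coeff γ ∈ U γ) σ with hσ₁
  set σ₂ := filterExponents (fun γ ↦ ¬ σ.coeff γ ∈ U γ) σ with hσ₂
  have hsum : σ₁ + σ₂ = σ := filterExponents_add_filterExponents_not _ σ
  have hmem₁ : ∀ γ, σ₁.coeff γ ∈ U γ := fun γ ↦ by
    by_cases hγ : σ.coeff γ ∈ U γ
    · rwa [hσ₁, coeff_filterExponents_of_pos (p := fun γ ↦ σ.coeff γ ∈ U γ) hγ]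
    · rw [hσ₁, coeff_filterExponents_of_neg (p := fun γ ↦ σ.coeff γ ∈ U γ) hγ]
      exact zero_mem _
  have hrad : σ₁ ∈ (monomialIdeal T hT).radical := mem_of_forall_single_mem fun γ ↦ by
    obtain ⟨n, hn⟩ := h1 γ _ (hmem₁ γ)
    exact ⟨n, by rwa [AddMonoidAlgebra.single_pow, single_mem_monomialIdeal]⟩
  have hreg : ∀ γ ∈ σ₂.coeff.support, σ₂.coeff γ ∉ U γ := by
    intro γ hγ
    rw [Finsupp.mem_support_iff] at hγ
    by_cases hp : σ.coeff γ ∈ U γ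
    · exact absurd (coeff_filterExponents_of_neg (p := fun γ ↦ ¬ σ.coeff γ ∈ U γ)
        (not_not.2 hp)) hγ
    · rwa [hσ₂, coeff_filterExponents_of_pos (p := fun γ ↦ ¬ σ.coeff γ ∈ U γ) hp]
  have hne : σ₂ ≠ 0 := fun h0 ↦ hσ (by
    rw [← hsum, h0, add_zero]
    exact hmem₁)
  obtain ⟨n, hn⟩ := hrad
  have hpow : σ₂ ^ n * h ∈ monomialIdeal T hT := by
    obtain ⟨c, hc⟩ := sub_dvd_pow_sub_pow σ₂ (-σ₁) n
    have : σ₂ ^ n * h = c * (σ * h) + (-1) ^ n * h * σ₁ ^ n := by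
      rw [← hsum]
      rw [neg_pow] at hc
      linear_combination h * hc
    rw [this]
    exact add_mem (Ideal.mul_mem_left _ _ hm) (Ideal.mul_mem_left _ _ hn)
  clear hn
  induction n with
  | zero => simpa using hpow
  | succ n ih =>
    refine ih (mem_monomialIdeal_of_mul_mem_of_regular h2 hne hreg ?_)
    rwa [← mul_assoc, ← pow_succ']

/-- A monomial ideal which is prime on monomials is prime. -/
lemma isPrime_monomialIdeal (h : ∀ γ δ d e, d ∉ U γ → d * e ∈ U (γ + δ) → e ∈ U δ)
    (hne : monomialIdeal U hU ≠ ⊤) : (monomialIdeal U hU).IsPrime :=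
  ⟨hne, fun {_ _} hm ↦ or_iff_not_imp_left.2 fun hσ ↦
    mem_monomialIdeal_of_mul_mem (fun _ _ hd ↦ ⟨1, by simpa using hd⟩) h hσ hm⟩

end MonomialIdeal

/-! ### Prime ideals of a commutative monoid -/

section MonoidPrimes

variable {Γ : Type*} [AddCommMonoid Γ]

lemma IsPrimeIdeal.zero_notMem {S : AddSemigroupIdeal Γ} (hS : IsPrimeIdeal S) : (0 : Γ) ∉ S :=
  fun h ↦ hS.1 (Set.eq_univ_of_forall fun x ↦ by simpa using S.add_mem x h)

lemma IsPrimeIdeal.add_notMem {S : AddSemigroupIdeal Γ} (hS : IsPrimeIdeal S) {a b : Γ}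
    (ha : a ∉ S) (hb : b ∉ S) : a + b ∉ S :=
  fun h ↦ (hS.2 a b h).elim ha hb

lemma IsPrimeIdeal.sum_notMem {S : AddSemigroupIdeal Γ} (hS : IsPrimeIdeal S) {ι : Type*}
    (F : Finset ι) {f : ι → Γ} (hf : ∀ i ∈ F, f i ∉ S) : ∑ i ∈ F, f i ∉ S := by
  classical
  induction F using Finset.induction_on with
  | empty => simpa using hS.zero_notMem
  | insert i F hi ih =>
    rw [Finset.sum_insert hi]
    exact hS.add_notMem (hf i (by simp)) (ih fun j hj ↦ hf j (by simp [hj]))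

lemma IsPrimeIdeal.nsmul_notMem {S : AddSemigroupIdeal Γ} (hS : IsPrimeIdeal S) {a : Γ}
    (ha : a ∉ S) (n : ℕ) : n • a ∉ S := by
  simpa using hS.sum_notMem (Finset.range n) (f := fun _ ↦ a) fun _ _ ↦ ha

lemma IsHeightOnePrime.isPrimeIdeal {S : AddSemigroupIdeal Γ} (hS : IsHeightOnePrime S) :
    IsPrimeIdeal S := hS.prop.1

/-- A height-one prime is minimal over each of the principal ideals `α + Γ` that it contains. (For
`α ∉ S` the statement holds with `t = α` and `m = 0`.) -/
lemma IsHeightOnePrime.exists_add_nsmul_eq {S : AddSemigroupIdeal Γ} (hS : IsHeightOnePrime S)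
    (α : Γ) {β : Γ} (hβ : β ∈ S) : ∃ t ∉ S, ∃ (m : ℕ) (c : Γ), t + m • β = α + c := by
  by_contra! hcon
  -- The elements dividing no `t + m • β` with `t ∉ S` form a prime ideal strictly below `S`.
  let S' : AddSemigroupIdeal Γ :=
    { carrier := {x | ∀ t ∉ S, ∀ (m : ℕ) (c : Γ), t + m • β ≠ x + c}
      vadd_mem' := fun c x hx t ht m d h ↦ hx t ht m (c + d) (by
        rw [h, vadd_eq_add]; abel) }
  have hmem : ∀ x, x ∈ S' ↔ ∀ t ∉ S, ∀ (m : ℕ) (c : Γ), t + m • β ≠ x + c := fun _ ↦ Iff.rfl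
  have hprime : IsPrimeIdeal S' := by
    refine ⟨fun h ↦ ?_, fun a b hab ↦ ?_⟩
    · have : (0 : Γ) ∈ (S' : Set Γ) := h ▸ Set.mem_univ _
      exact (hmem 0).1 this 0 hS.isPrimeIdeal.zero_notMem 0 0 (by simp)
    · by_contra! hn
      obtain ⟨ha, hb⟩ := hn
      simp only [hmem] at ha hb
      push Not at ha hb
      obtain ⟨t, ht, m, c, h⟩ := ha
      obtain ⟨t', ht', m', c', h'⟩ := hb
      refine (hmem _).1 hab (t + t') (hS.isPrimeIdeal.add_notMem ht ht') (m + m') (c + c') ?_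
      calc t + t' + (m + m') • β = (t + m • β) + (t' + m' • β) := by rw [add_nsmul]; abel
        _ = _ := by rw [h, h']; abel
  have hle : S' ≤ S := by
    intro x hx
    by_contra hxS
    exact (hmem x).1 hx x hxS 0 0 (by simp)
  have hge : S ≤ S' := hS.le_of_le ⟨hprime, α, (hmem α).2 hcon⟩ hle
  exact (hmem β).1 (hge hβ) 0 hS.isPrimeIdeal.zero_notMem 1 0 (by simp)

/-- The ideal `(α + Γ_S) ∩ Γ` of the elements divisible by `α` locally at the prime `S`. -/
def locallyAboveIdeal (α : Γ) {S : AddSemigroupIdeal Γ} (_hS : IsPrimeIdeal S) :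
    AddSemigroupIdeal Γ where
  carrier := {γ | ∃ t ∉ S, ∃ c : Γ, t + γ = α + c}
  vadd_mem' := by
    rintro d γ ⟨t, ht, c, h⟩
    exact ⟨t, ht, d + c, by rw [vadd_eq_add, add_left_comm, h]; abel⟩

lemma mem_locallyAboveIdeal {α : Γ} {S : AddSemigroupIdeal Γ} {hS : IsPrimeIdeal S} {γ : Γ} :
    γ ∈ locallyAboveIdeal α hS ↔ ∃ t ∉ S, ∃ c : Γ, t + γ = α + c := Iff.rfl

end MonoidPrimes

/-! ### The extended ideals `P[Γ]` and `D[S]` -/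

section ExtendedIdeals

variable {D Γ : Type*} [CommRing D] [AddCommMonoid Γ]

open AddMonoidAlgebra (single)

variable (Γ) in
/-- The ideal `P[Γ]` of `D[Γ]`. -/
def coeffIdeal (P : Ideal D) : Ideal (AddMonoidAlgebra D Γ) :=
  monomialIdeal (fun _ ↦ P) fun _ _ ↦ le_rfl

lemma mem_coeffIdeal {P : Ideal D} {f : AddMonoidAlgebra D Γ} :
    f ∈ coeffIdeal Γ P ↔ ∀ γ, f.coeff γ ∈ P := Iff.rfl

lemma single_mem_coeffIdeal {P : Ideal D} {γ : Γ} {d : D} :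
    single γ d ∈ coeffIdeal Γ P ↔ d ∈ P := single_mem_monomialIdeal

lemma coeffIdeal_le_coeffIdeal {P Q : Ideal D} : coeffIdeal Γ P ≤ coeffIdeal Γ Q ↔ P ≤ Q :=
  ⟨fun h _ hd ↦ (single_mem_coeffIdeal (γ := (0 : Γ))).1 (h (single_mem_coeffIdeal.2 hd)),
    fun h _ hf γ ↦ h (hf γ)⟩

lemma coeffIdeal_injective : Function.Injective (coeffIdeal Γ : Ideal D → _) := fun _ _ h ↦
  le_antisymm (coeffIdeal_le_coeffIdeal.1 h.le) (coeffIdeal_le_coeffIdeal.1 h.ge)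

lemma coeffIdeal_ne_bot {P : Ideal D} (hP : P ≠ ⊥) : coeffIdeal Γ P ≠ ⊥ := by
  obtain ⟨d, hd, hd0⟩ := Submodule.exists_mem_ne_zero_of_ne_bot hP
  intro h
  have : single (0 : Γ) d ∈ coeffIdeal Γ P := single_mem_coeffIdeal.2 hd
  rw [h, Ideal.mem_bot, AddMonoidAlgebra.single_eq_zero] at this
  exact hd0 this

/-- An ideal of `D[Γ]` contains the extension of its contraction to `D`. -/
lemma coeffIdeal_le {P : Ideal D} {Q : Ideal (AddMonoidAlgebra D Γ)}
    (h : ∀ d ∈ P, single 0 d ∈ Q) : coeffIdeal Γ P ≤ Q := fun f hf ↦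
  mem_of_forall_single_mem fun γ ↦ by
    rw [show single γ (f.coeff γ) = single γ 1 * single 0 (f.coeff γ) by simp]
    exact Ideal.mul_mem_left _ _ (h _ (hf γ))

variable (D) in
/-- The coefficient ideals of `D[S]`. -/
noncomputable def exponentCoeff (S : AddSemigroupIdeal Γ) (γ : Γ) : Ideal D :=
  open Classical in if γ ∈ S then ⊤ else ⊥

lemma mem_exponentCoeff {S : AddSemigroupIdeal Γ} {γ : Γ} {d : D} :
    d ∈ exponentCoeff D S γ ↔ (d ≠ 0 → γ ∈ S) := by
  unfold exponentCoeff
  split_ifs with h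
  · simp [h]
  · simp [h]

variable (D) in
/-- The ideal `D[S]` of `D[Γ]`. -/
noncomputable def exponentIdeal (S : AddSemigroupIdeal Γ) : Ideal (AddMonoidAlgebra D Γ) :=
  monomialIdeal (exponentCoeff D S) fun γ _ _ hd ↦
    mem_exponentCoeff.2 fun h0 ↦ S.add_mem γ (mem_exponentCoeff.1 hd h0)

lemma mem_exponentIdeal {S : AddSemigroupIdeal Γ} {f : AddMonoidAlgebra D Γ} :
    f ∈ exponentIdeal D S ↔ ∀ γ, f.coeff γ ≠ 0 → γ ∈ S :=
  forall_congr' fun _ ↦ mem_exponentCoeff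

lemma single_mem_exponentIdeal {S : AddSemigroupIdeal Γ} {γ : Γ} {d : D} (hd : d ≠ 0) :
    single γ d ∈ exponentIdeal D S ↔ γ ∈ S :=
  single_mem_monomialIdeal.trans (mem_exponentCoeff.trans (by simp [hd]))

lemma exponentIdeal_le_exponentIdeal [Nontrivial D] {S T : AddSemigroupIdeal Γ} :
    exponentIdeal D S ≤ exponentIdeal D T ↔ S ≤ T :=
  ⟨fun h _ hs ↦ (single_mem_exponentIdeal one_ne_zero).1
    (h ((single_mem_exponentIdeal one_ne_zero).2 hs)),
    fun h _ hf ↦ mem_exponentIdeal.2 fun γ h0 ↦ h (mem_exponentIdeal.1 hf γ h0)⟩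

lemma exponentIdeal_injective [Nontrivial D] :
    Function.Injective (exponentIdeal D : AddSemigroupIdeal Γ → _) := fun _ _ h ↦
  le_antisymm (exponentIdeal_le_exponentIdeal.1 h.le) (exponentIdeal_le_exponentIdeal.1 h.ge)

lemma exponentIdeal_ne_bot [Nontrivial D] {S : AddSemigroupIdeal Γ} (hS : (S : Set Γ).Nonempty) :
    exponentIdeal D S ≠ ⊥ := by
  obtain ⟨γ, hγ⟩ := hS
  intro h
  have : single γ (1 : D) ∈ exponentIdeal D S := (single_mem_exponentIdeal one_ne_zero).2 hγ
  rw [h, Ideal.mem_bot, AddMonoidAlgebra.single_eq_zero] at this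
  exact one_ne_zero this

lemma exponentIdeal_le {S : AddSemigroupIdeal Γ} {Q : Ideal (AddMonoidAlgebra D Γ)}
    (h : ∀ γ ∈ S, single γ 1 ∈ Q) : exponentIdeal D S ≤ Q := fun f hf ↦
  mem_of_forall_single_mem fun γ ↦ by
    by_cases h0 : f.coeff γ = 0
    · simp [h0]
    rw [show single γ (f.coeff γ) = single 0 (f.coeff γ) * single γ 1 by simp]
    exact Ideal.mul_mem_left _ _ (h _ (mem_exponentIdeal.1 hf γ h0))

/-- The ideal of `Γ` formed by the exponents `γ` with `X ^ γ ∈ Q`. -/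
def exponentsOf (Q : Ideal (AddMonoidAlgebra D Γ)) : AddSemigroupIdeal Γ where
  carrier := {γ | single γ (1 : D) ∈ Q}
  vadd_mem' := fun c γ hγ ↦ by
    change single (c + γ) (1 : D) ∈ Q
    rw [← one_mul (1 : D), ← AddMonoidAlgebra.single_mul_single]
    exact Q.mul_mem_left _ hγ

lemma isPrimeIdeal_exponentsOf {Q : Ideal (AddMonoidAlgebra D Γ)} (hQ : Q.IsPrime) :
    IsPrimeIdeal (exponentsOf Q) := by
  refine ⟨fun h ↦ ?_, fun a b hab ↦ ?_⟩
  · have : (0 : Γ) ∈ (exponentsOf Q : Set Γ) := h ▸ Set.mem_univ _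
    exact hQ.one_notMem this
  · refine hQ.mem_or_mem (x := single a 1) (y := single b 1) ?_
    rw [AddMonoidAlgebra.single_mul_single, one_mul]
    exact hab

/-- Divisibility by a monomial is tested on monomials. -/
lemma single_dvd_of_forall {α : Γ} {d : D} {f : AddMonoidAlgebra D Γ}
    (h : ∀ γ, f.coeff γ ≠ 0 → (∃ c, γ = α + c) ∧ d ∣ f.coeff γ) : single α d ∣ f := by
  rw [← Ideal.mem_span_singleton]
  refine mem_of_forall_single_mem fun γ ↦ ?_
  by_cases h0 : f.coeff γ = 0
  · simp [h0]
  obtain ⟨⟨c, hc⟩, e, he⟩ := h γ h0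
  exact Ideal.mem_span_singleton.2 ⟨single c e, by
    rw [AddMonoidAlgebra.single_mul_single, ← hc, ← he]⟩

lemma of_single_dvd {α : Γ} {d : D} {f : AddMonoidAlgebra D Γ} (h : single α d ∣ f) (γ : Γ)
    (hγ : f.coeff γ ≠ 0) : (∃ c, γ = α + c) ∧ d ∣ f.coeff γ := by
  classical
  constructor
  · let S : AddSemigroupIdeal Γ :=
      { carrier := {γ | ∃ c, γ = α + c}
        vadd_mem' := by
          rintro c _ ⟨e, rfl⟩
          exact ⟨c + e, by rw [vadd_eq_add]; abel⟩ }
    have hS : single α d ∈ exponentIdeal D S := mem_exponentIdeal.2 fun γ hγ ↦ by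
      rw [AddMonoidAlgebra.coeff_single, Finsupp.single_apply] at hγ
      exact ⟨0, by simpa [eq_comm] using (ite_ne_right_iff.1 hγ).1⟩
    exact mem_exponentIdeal.1 (Ideal.mem_of_dvd _ h hS) γ hγ
  · have hd : single α d ∈ coeffIdeal Γ (Ideal.span {d}) :=
      single_mem_coeffIdeal.2 (Ideal.mem_span_singleton_self d)
    exact Ideal.mem_span_singleton.1 (mem_coeffIdeal.1 (Ideal.mem_of_dvd _ h hd) γ)

lemma IsMinimalOver.isMinimalOver_coeffIdeal {a : D} {P : Ideal D} (hP : P.IsPrime)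
    (h : IsMinimalOver a P) : IsMinimalOver (single 0 a) (coeffIdeal Γ P) := by
  refine ⟨by simpa using h.1, single_mem_coeffIdeal.2 h.2.1, fun f hf ↦ ?_⟩
  have hrad : f ∈ (coeffIdeal Γ (locallyDivisibleIdeal a hP)).radical :=
    mem_of_forall_single_mem fun γ ↦ by
      obtain ⟨s, hs, m, hm⟩ := h.2.2 _ (hf γ)
      exact ⟨m, by
        rw [AddMonoidAlgebra.single_pow]
        exact single_mem_coeffIdeal.2 ⟨s, hs, hm⟩⟩
  obtain ⟨m, hm⟩ := hrad
  choose s hs hdvd using hm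
  refine ⟨single 0 (∏ γ ∈ (f ^ m).coeff.support, s γ), fun hmem ↦ ?_, m, ?_⟩
  · rw [single_mem_coeffIdeal, Ideal.IsPrime.prod_mem_iff (hp := hP)] at hmem
    obtain ⟨γ, -, h⟩ := hmem
    exact hs γ h
  · refine single_dvd_of_forall fun γ hγ ↦ ⟨⟨γ, by simp⟩, ?_⟩
    rw [AddMonoidAlgebra.coeff_single_zero_mul] at hγ ⊢
    have hsupp : γ ∈ (f ^ m).coeff.support := by
      rw [Finsupp.mem_support_iff]
      exact right_ne_zero_of_mul hγ
    exact (hdvd γ).trans (mul_dvd_mul_right (Finset.dvd_prod_of_mem s hsupp) _)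

lemma IsHeightOnePrime.isMinimalOver_exponentIdeal [IsDomain D] {S : AddSemigroupIdeal Γ}
    (hS : IsHeightOnePrime S) {α : Γ} (hα : α ∈ S) :
    IsMinimalOver (single α 1) (exponentIdeal D S) := by
  refine ⟨by simp, (single_mem_exponentIdeal one_ne_zero).2 hα, fun f hf ↦ ?_⟩
  have hrad : f ∈ (exponentIdeal D (locallyAboveIdeal α hS.isPrimeIdeal)).radical :=
    mem_of_forall_single_mem fun γ ↦ by
      by_cases h0 : f.coeff γ = 0
      · simp [h0]
      obtain ⟨t, ht, m, c, h⟩ := hS.exists_add_nsmul_eq α (mem_exponentIdeal.1 hf γ h0)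
      refine ⟨m, ?_⟩
      rw [AddMonoidAlgebra.single_pow]
      exact (single_mem_exponentIdeal (pow_ne_zero m h0)).2 ⟨t, ht, c, h⟩
  obtain ⟨m, hm⟩ := hrad
  rw [mem_exponentIdeal] at hm
  simp only [mem_locallyAboveIdeal] at hm
  choose! t ht c hc using hm
  refine ⟨single (∑ γ ∈ (f ^ m).coeff.support, t γ) 1, fun hmem ↦ ?_, m, ?_⟩
  · rw [single_mem_exponentIdeal one_ne_zero] at hmem
    exact hS.isPrimeIdeal.sum_notMem _ (fun γ hγ ↦ ht γ (Finsupp.mem_support_iff.1 hγ)) hmem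
  · obtain ⟨F, hF⟩ : ∃ F, F = (f ^ m).coeff.support := ⟨_, rfl⟩
    rw [← Ideal.mem_span_singleton, ← hF, ← AddMonoidAlgebra.sum_coeff_single (f ^ m),
      Finsupp.sum, ← hF, Finset.mul_sum]
    refine Ideal.sum_mem _ fun γ hγ ↦ Ideal.mem_span_singleton.2 ?_
    classical
    refine ⟨single (∑ δ ∈ F.erase γ, t δ + c γ) ((f ^ m).coeff γ), ?_⟩
    rw [AddMonoidAlgebra.single_mul_single, AddMonoidAlgebra.single_mul_single]
    congr 1
    rw [← Finset.add_sum_erase _ t hγ, add_right_comm,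
      hc γ (Finsupp.mem_support_iff.1 (hF ▸ hγ))]
    abel

variable [UniqueSums Γ]

lemma isPrime_coeffIdeal {P : Ideal D} (hP : P.IsPrime) : (coeffIdeal Γ P).IsPrime :=
  isPrime_monomialIdeal (fun _ _ _ _ hd hde ↦ (hP.mem_or_mem hde).resolve_left hd) fun h ↦
    hP.one_notMem ((single_mem_coeffIdeal (γ := (0 : Γ))).1
      ((Ideal.eq_top_iff_one (coeffIdeal Γ P)).1 h))

lemma isPrime_exponentIdeal [IsDomain D] {S : AddSemigroupIdeal Γ} (hS : IsPrimeIdeal S) :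
    (exponentIdeal D S).IsPrime := by
  refine isPrime_monomialIdeal (fun γ δ d e hd hde ↦ ?_) fun h ↦
    hS.zero_notMem ((single_mem_exponentIdeal (D := D) one_ne_zero).1
      ((Ideal.eq_top_iff_one (exponentIdeal D S)).1 h))
  rw [mem_exponentCoeff] at hd hde ⊢
  push Not at hd
  exact fun he ↦ (hS.2 _ _ (hde (mul_ne_zero hd.1 he))).resolve_left hd.2

/-- If `P` is minimal over `(a)`, then `aD_P[Γ] ∩ D[Γ]` is `P[Γ]`-primary. -/
lemma IsMinimalOver.mem_coeffIdeal_of_mul_mem {a : D} {P : Ideal D} (hP : P.IsPrime)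
    (h : IsMinimalOver a P) {σ f : AddMonoidAlgebra D Γ} (hσ : σ ∉ coeffIdeal Γ P)
    (hm : σ * f ∈ coeffIdeal Γ (locallyDivisibleIdeal a hP)) :
    f ∈ coeffIdeal Γ (locallyDivisibleIdeal a hP) := by
  refine mem_monomialIdeal_of_mul_mem ?_ ?_ hσ hm
  · intro _ d hd
    obtain ⟨s, hs, m, hdvd⟩ := h.2.2 d hd
    exact ⟨m, s, hs, hdvd⟩
  · rintro _ _ d e hd ⟨s, hs, hdvd⟩
    exact ⟨s * d, fun hm ↦ (hP.mem_or_mem hm).elim hs hd, by rwa [mul_assoc]⟩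

/-- If `S` is a height-one prime containing `α`, then `D[α + Γ_S] ∩ D[Γ]` is `D[S]`-primary. -/
lemma IsHeightOnePrime.mem_exponentIdeal_of_mul_mem [IsDomain D] {S : AddSemigroupIdeal Γ}
    (hS : IsHeightOnePrime S) {α : Γ} {σ f : AddMonoidAlgebra D Γ}
    (hσ : σ ∉ exponentIdeal D S)
    (hm : σ * f ∈ exponentIdeal D (locallyAboveIdeal α hS.isPrimeIdeal)) :
    f ∈ exponentIdeal D (locallyAboveIdeal α hS.isPrimeIdeal) := by
  refine mem_monomialIdeal_of_mul_mem ?_ ?_ hσ hm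
  · intro γ d hd
    rw [mem_exponentCoeff] at hd
    by_cases hd0 : d = 0
    · exact ⟨1, by simp [hd0]⟩
    obtain ⟨t, ht, m, c, h⟩ := hS.exists_add_nsmul_eq α (hd hd0)
    exact ⟨m, mem_exponentCoeff.2 fun _ ↦ ⟨t, ht, c, h⟩⟩
  · intro γ δ d e hd hde
    rw [mem_exponentCoeff] at hd hde ⊢
    push Not at hd
    intro he
    obtain ⟨t, ht, c, h⟩ := hde (mul_ne_zero hd.1 he)
    exact ⟨t + γ, hS.isPrimeIdeal.add_notMem ht hd.2, c, by rw [add_assoc, h]⟩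

end ExtendedIdeals

/-! ### Uppers to zero and the UMT property of a weakly Krull domain -/

section UMTDomain

open Polynomial

lemma IsMinimalOver.comap_ringEquiv {A B : Type*} [CommRing A] [CommRing B] (e : A ≃+* B) {a : A}
    {U : Ideal B} (h : IsMinimalOver (e a) U) : IsMinimalOver a (U.comap (e : A →+* B)) := by
  refine ⟨fun h0 ↦ h.1 (by simp [h0]), h.2.1, fun f hf ↦ ?_⟩
  obtain ⟨s, hs, m, hm⟩ := h.2.2 (e f) hf
  obtain ⟨s, rfl⟩ := e.surjective s
  exact ⟨s, hs, m, by rwa [← map_pow, ← map_mul, map_dvd_iff] at hm⟩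

lemma comap_coeffIdeal_nat {D : Type*} [CommRing D] (P : Ideal D) :
    (coeffIdeal ℕ P).comap (toFinsuppIso D : D[X] →+* AddMonoidAlgebra D ℕ) = P.map C := by
  ext f
  rw [Ideal.mem_map_C_iff, Ideal.mem_comap, mem_coeffIdeal]
  exact forall_congr' fun n ↦ by simp [toFinsupp_apply]

variable {D : Type*} [CommRing D] [IsDomain D]

/-- Uppers to zero have height one, because they are contracted from `K[X]`. Moreover a larger
ideal which is not contained in them meets `D`. -/
lemma isHeightOne_of_comap_C_eq_bot {Q : Ideal D[X]} (hQ : Q.IsPrime) (hQ0 : Q ≠ ⊥)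
    (hQD : Q.comap C = ⊥) :
    IsHeightOne Q ∧ ∀ I : Ideal D[X], Q ≤ I → ¬ I ≤ Q → ∃ d : D, d ≠ 0 ∧ C d ∈ I := by
  let _ : Algebra D[X] (FractionRing D)[X] := Polynomial.algebra D (FractionRing D)
  have hloc : IsLocalization (D⁰.map (C : D →+* D[X])) (FractionRing D)[X] :=
    Polynomial.isLocalization D⁰ (FractionRing D)
  have hdis : Disjoint ((D⁰.map (C : D →+* D[X]) : Submonoid D[X]) : Set D[X]) Q := by
    rw [Set.disjoint_left]
    rintro _ ⟨d, hd, rfl⟩ hdQ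
    have : d ∈ Q.comap C := hdQ
    rw [hQD, Ideal.mem_bot] at this
    exact nonZeroDivisors.ne_zero hd this
  have hprime := IsLocalization.isPrime_of_isPrime_disjoint _ (FractionRing D)[X] Q hQ hdis
  have hcomap : (Q.map (algebraMap D[X] (FractionRing D)[X])).comap _ = Q :=
    IsLocalization.under_map_of_isPrime_disjoint _ (FractionRing D)[X] hQ hdis
  have hne : Q.map (algebraMap D[X] (FractionRing D)[X]) ≠ ⊥ := by
    intro h
    rw [h] at hcomap
    refine hQ0 (hcomap.symm.trans ((RingHom.injective_iff_ker_eq_bot _).1 ?_))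
    exact Polynomial.map_injective _ (IsFractionRing.injective D (FractionRing D))
  have hmax := hprime.isMaximal hne
  constructor
  · rw [← hcomap]
    refine IsHeightOne.comap_of_isLocalization (D⁰.map (C : D →+* D[X])) ⟨⟨hprime, hne⟩, ?_⟩
    rintro Q' ⟨hQ', hQ'0⟩ hle
    exact ((hQ'.isMaximal hQ'0).eq_of_le hprime.ne_top hle).ge
  · intro I hQI hIQ
    by_contra! hI
    have hdI : Disjoint ((D⁰.map (C : D →+* D[X]) : Submonoid D[X]) : Set D[X]) I := by
      rw [Set.disjoint_left]
      rintro _ ⟨d, hd, rfl⟩ hdI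
      exact hI d (nonZeroDivisors.ne_zero hd) hdI
    have htop : I.map (algebraMap D[X] (FractionRing D)[X]) ≠ ⊤ :=
      (IsLocalization.map_algebraMap_ne_top_iff_disjoint _ _ I).2 hdI
    have := hmax.eq_of_le htop (Ideal.map_mono hQI)
    refine hIQ ?_
    rw [← hcomap, this]
    exact Ideal.le_comap_map

/-- If `d ∣ u * q` in `D[X]`, and the content of `q` lies in no height-one prime containing `d`,
then `d ∣ u`. -/
lemma C_dvd_of_C_dvd_mul (hD : IsWeaklyKrullDomain D) {d : D} (hd : d ≠ 0) {u q : D[X]}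
    (hq : ∀ P : Ideal D, IsHeightOne P → d ∈ P → q ∉ P.map C) (h : C d ∣ u * q) : C d ∣ u := by
  rw [C_dvd_iff_dvd_coeff] at h ⊢
  intro n
  refine (isWeaklyKrullDomain_iff.1 hD).1 d _ hd fun P hP ↦ ?_
  by_cases hdP : d ∈ P
  swap
  · exact ⟨d, hdP, dvd_mul_right _ _⟩
  have hmem := (hP.isMinimalOver hdP hd).mem_coeffIdeal_of_mul_mem hP.isPrime
    (σ := toFinsuppIso D q) (f := toFinsuppIso D u)
    (fun hmem ↦ hq P hP hdP (by rwa [← comap_coeffIdeal_nat])) (fun n ↦ by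
      refine ⟨1, hP.isPrime.one_notMem, ?_⟩
      rw [← map_mul, one_mul, mul_comm]
      simpa [← toFinsupp_mul, toFinsupp_apply] using h n)
  simpa [toFinsupp_apply, mem_locallyDivisibleIdeal] using hmem n

/-- A weakly Krull domain is a UMT-domain if and only if no upper to zero lies in `P[X]` for a
height-one prime `P`. -/
theorem isUMTDomain_iff (hD : IsWeaklyKrullDomain D) : IsUMTDomain D ↔
    ∀ Q : Ideal D[X], Q.IsPrime → Q ≠ ⊥ → Q.comap C = ⊥ → ∀ P : Ideal D, IsHeightOne P →
      ¬ Q ≤ P.map C := by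
  constructor
  · intro h Q hQ hQ0 hQD P hP hle
    have hPX : IsTIdeal (P.map (C : D →+* D[X]) : FractionalIdeal D[X]⁰ (FractionRing D[X])) := by
      obtain ⟨a, ha, ha0⟩ := hP.exists_ne_zero
      have := hP.isPrime
      refine IsMinimalOver.isTIdeal (a := C a) inferInstance ?_
      rw [← comap_coeffIdeal_nat]
      refine IsMinimalOver.comap_ringEquiv _ ?_
      simpa using (hP.isMinimalOver ha ha0).isMinimalOver_coeffIdeal (Γ := ℕ) hP.isPrime
    have hne : P.map (C : D →+* D[X]) ≠ ⊤ := by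
      have := hP.isPrime
      exact Ideal.IsPrime.ne_top inferInstance
    have hge := (h Q hQ hQ0 hQD).le_of_ge ⟨hne, hPX⟩ hle
    refine hP.ne_bot (eq_bot_iff.2 fun d hd ↦ ?_)
    rw [← hQD]
    exact hge (Ideal.mem_map_of_mem C hd)
  · intro h Q hQ hQ0 hQD
    obtain ⟨hht, hmeet⟩ := isHeightOne_of_comap_C_eq_bot hQ hQ0 hQD
    obtain ⟨g, hg, hg0⟩ := hht.exists_ne_zero
    refine ⟨⟨hQ.ne_top, (hht.isMinimalOver hg hg0).isTIdeal hQ⟩, ?_⟩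
    rintro I ⟨hI, hIt⟩ hQI
    by_contra hIQ
    obtain ⟨d, hd0, hdI⟩ := hmeet I hQI hIQ
    have hfin := (isWeaklyKrullDomain_iff.1 hD).2 d hd0
    obtain ⟨q, hqQ, hq⟩ : ∃ q ∈ Q, ∀ P : Ideal D, IsHeightOne P → d ∈ P → q ∉ P.map C := by
      by_contra! hcon
      have hsub : (Q : Set D[X]) ⊆ ⋃ P ∈ {P : Ideal D | IsHeightOne P ∧ d ∈ P},
          ((P.map C : Ideal D[X]) : Set D[X]) := by
        intro q hq
        obtain ⟨P, hP, hdP, hqP⟩ := hcon q hq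
        exact Set.mem_biUnion (show P ∈ {P : Ideal D | IsHeightOne P ∧ d ∈ P} from ⟨hP, hdP⟩) hqP
      obtain ⟨P, hP, hle⟩ := (Ideal.subset_union_prime_finite hfin
        (f := fun P : Ideal D ↦ P.map (C : D →+* D[X])) ⊥ ⊥ fun P hP _ _ ↦ by
          have := hP.1.isPrime
          infer_instance).1 hsub
      exact h Q hQ hQ0 hQD P hP.1 hle
    -- The ideal `(d, q)` has trivial inverse, so its `t`-closure is the whole ring.
    refine hI ((Ideal.eq_top_iff_one I).2 ((isTIdeal_coeIdeal_iff.1 hIt).2 (Ideal.span {C d, q})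
      (Submodule.fg_span (Set.toFinite _)) ?_ ?_ 1 ?_))
    · intro hb
      have : C d ∈ Ideal.span {C d, q} := Ideal.subset_span (by simp)
      rw [hb, Ideal.mem_bot, C_eq_zero] at this
      exact hd0 this
    · refine Ideal.span_le.2 ?_
      rintro z (rfl | rfl)
      exacts [hdI, hQI hqQ]
    · intro c a ha hca
      rw [mul_one]
      obtain ⟨u, hu⟩ := hca (C d) (Ideal.subset_span (by simp))
      obtain ⟨v, hv⟩ := hca q (Ideal.subset_span (by simp))
      obtain ⟨w, rfl⟩ := C_dvd_of_C_dvd_mul hD hd0 hq (u := u) ⟨v, by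
        refine mul_left_cancel₀ ha ?_
        linear_combination (-q) * hu + C d * hv⟩
      exact ⟨w, mul_left_cancel₀ (C_ne_zero.2 hd0) (by linear_combination hu)⟩

/-- Over a weakly Krull UMT-domain with a height-one prime `P`, each element of the quotient field
is a root of a polynomial whose coefficients are not all in `P`. -/
lemma IsUMTDomain.exists_aeval_eq_zero {K : Type*} [Field K] [Algebra D K] [IsFractionRing D K]
    (hD : IsWeaklyKrullDomain D) (h : IsUMTDomain D) {P : Ideal D} (hP : IsHeightOne P) (x : K) :
    ∃ p : D[X], aeval x p = 0 ∧ ∃ n, p.coeff n ∉ P := by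
  have hinj := IsFractionRing.injective D K
  have hprime : (RingHom.ker (aeval x : D[X] →ₐ[D] K)).IsPrime := RingHom.ker_isPrime _
  obtain ⟨b, a, ha, rfl⟩ := IsFractionRing.div_surjective (A := D) x
  have ha' : algebraMap D K a ≠ 0 := by simpa using nonZeroDivisors.ne_zero ha
  have := (isUMTDomain_iff hD).1 h _ hprime (fun hb ↦ ?_) ?_ P hP
  · obtain ⟨p, hp, hpP⟩ := SetLike.not_le_iff_exists.1 this
    rw [Ideal.mem_map_C_iff] at hpP
    push Not at hpP
    exact ⟨p, hp, hpP⟩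
  · have hmem : C a * X - C b ∈
        RingHom.ker (aeval (algebraMap D K b / algebraMap D K a) : D[X] →ₐ[D] K) := by
      rw [RingHom.mem_ker, map_sub, map_mul, aeval_C, aeval_C, aeval_X]
      field_simp
      simp
    rw [hb, Ideal.mem_bot] at hmem
    have := congrArg (fun p ↦ p.coeff 1) hmem
    simp at this
    exact nonZeroDivisors.ne_zero ha this
  · rw [eq_bot_iff]
    intro d hd
    rw [Ideal.mem_comap, RingHom.mem_ker, aeval_C] at hd
    exact hinj (by simpa using hd)

end UMTDomain

/-! ### Weakly Krull monoids and UMT-monoids -/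

section WeaklyKrullMonoid

open Algebra (GrothendieckAddGroup)

variable {Γ : Type*} [AddCommMonoid Γ]

lemma exists_eq_of_sub_of (g : GrothendieckAddGroup Γ) :
    ∃ a b : Γ, g = GrothendieckAddGroup.of a - GrothendieckAddGroup.of b := by
  obtain ⟨⟨a, b⟩, h⟩ := (AddLocalization.addMonoidOf (⊤ : AddSubmonoid Γ)).surj g
  exact ⟨a, b, eq_sub_of_add_eq h⟩

lemma mem_base {g : GrothendieckAddGroup Γ} :
    g ∈ base Γ ↔ ∃ a : Γ, GrothendieckAddGroup.of a = g := AddMonoidHom.mem_mrange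

lemma of_mem_base (a : Γ) : GrothendieckAddGroup.of a ∈ base Γ := mem_base.2 ⟨a, rfl⟩

lemma mem_localizationAt_rootClosure {S : AddSemigroupIdeal Γ} (hS : IsPrimeIdeal S)
    {g : GrothendieckAddGroup Γ} : g ∈ localizationAt (rootClosure Γ) S ↔
      ∃ n : ℕ, 1 ≤ n ∧ ∃ δ : Γ, ∃ τ ∉ S,
        n • g = GrothendieckAddGroup.of δ - GrothendieckAddGroup.of τ := by
  constructor
  · rintro ⟨x, ⟨n, hn, hx⟩, s, hs, rfl⟩
    obtain ⟨δ, hδ⟩ := mem_base.1 hx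
    exact ⟨n, hn, δ, n • s, hS.nsmul_notMem hs n, by rw [nsmul_sub, hδ, map_nsmul]⟩
  · rintro ⟨n, hn, δ, τ, hτ, h⟩
    refine ⟨g + GrothendieckAddGroup.of τ, ⟨n, hn, ?_⟩, τ, hτ, by abel⟩
    obtain ⟨k, rfl⟩ := Nat.exists_eq_add_of_le hn
    rw [nsmul_add, h, ← map_nsmul, add_nsmul, one_nsmul, map_add]
    exact mem_base.2 ⟨δ + k • τ, by rw [map_add]; abel⟩

/-- A localization of the root closure is a valuation monoid if and only if it contains each
element of the quotient group or its negative. -/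
lemma isValuationMonoid_localizationAt_iff {S : AddSemigroupIdeal Γ} (hS : IsPrimeIdeal S) :
    IsValuationMonoid (localizationAt (rootClosure Γ) S) ↔
      ∀ g, g ∈ localizationAt (rootClosure Γ) S ∨ -g ∈ localizationAt (rootClosure Γ) S := by
  constructor
  · intro h g
    obtain ⟨a, b, rfl⟩ := exists_eq_of_sub_of g
    have hmem : ∀ a : Γ, GrothendieckAddGroup.of a ∈ localizationAt (rootClosure Γ) S := fun a ↦
      ⟨_, ⟨1, le_rfl, by simpa using of_mem_base a⟩, 0, hS.zero_notMem, by simp⟩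
    rcases h _ (hmem b) _ (hmem a) with ⟨c, hc, he⟩ | ⟨c, hc, he⟩
    · left
      rwa [he, add_sub_cancel_left]
    · right
      rwa [he, neg_sub, add_sub_cancel_left]
  · intro h a _ b _
    rcases h (b - a) with hc | hc
    · exact .inl ⟨_, hc, by abel⟩
    · exact .inr ⟨_, hc, by abel⟩

variable [IsCancelAdd Γ]

lemma of_sub_of_eq_iff {a b c d : Γ} :
    GrothendieckAddGroup.of a - GrothendieckAddGroup.of b =
      GrothendieckAddGroup.of c - GrothendieckAddGroup.of d ↔ a + d = c + b := by
  rw [sub_eq_sub_iff_add_eq_add, ← map_add, ← map_add,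
    GrothendieckAddGroup.of_injective.eq_iff]

lemma of_sub_of_mem_base_iff {a b : Γ} :
    GrothendieckAddGroup.of b - GrothendieckAddGroup.of a ∈ base Γ ↔ ∃ c, b = a + c := by
  rw [mem_base]
  refine exists_congr fun c ↦ ?_
  rw [eq_sub_iff_add_eq, ← map_add, GrothendieckAddGroup.of_injective.eq_iff, add_comm, eq_comm]

/-- The defining intersection of a weakly Krull monoid, tested on differences `b - a`. -/
theorem isWeaklyKrullMonoid_iff : IsWeaklyKrullMonoid Γ ↔
    (∀ a b : Γ, (∀ S : AddSemigroupIdeal Γ, IsHeightOnePrime S → ∃ t ∉ S, ∃ c, t + b = a + c) →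
      ∃ c, b = a + c) ∧
    ∀ a : Γ, {S : AddSemigroupIdeal Γ | IsHeightOnePrime S ∧ a ∈ S}.Finite := by
  have key : ∀ (S : AddSemigroupIdeal Γ) (a b : Γ),
      GrothendieckAddGroup.of b - GrothendieckAddGroup.of a ∈ localizationAt (base Γ) S ↔
        ∃ t ∉ S, ∃ c, t + b = a + c := by
    intro S a b
    constructor
    · rintro ⟨x, hx, t, ht, h⟩
      obtain ⟨c, rfl⟩ := mem_base.1 hx
      exact ⟨t, ht, c, by rw [add_comm, of_sub_of_eq_iff.1 h, add_comm]⟩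
    · rintro ⟨t, ht, c, h⟩
      exact ⟨_, of_mem_base c, t, ht, of_sub_of_eq_iff.2 (by rw [add_comm, h, add_comm])⟩
  constructor
  · rintro ⟨h1, h2⟩
    constructor
    · intro a b hab
      rw [← of_sub_of_mem_base_iff, ← SetLike.mem_coe, ← h1, Set.mem_iInter]
      exact fun S ↦ (key S.1 a b).2 (hab S.1 S.2)
    · intro a
      by_cases ha : IsAddUnit a
      · convert Set.finite_empty
        ext S
        simp only [Set.mem_ofPred_eq, Set.mem_empty_iff_false, iff_false, not_and]
        intro hS haS
        obtain ⟨b, hb⟩ := ha.exists_neg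
        refine hS.isPrimeIdeal.zero_notMem ?_
        rw [← hb, add_comm]
        exact S.add_mem b haS
      · exact h2 a ha
  · rintro ⟨h1, h2⟩
    refine ⟨Set.Subset.antisymm ?_ ?_, fun a _ ↦ h2 a⟩
    · intro g hg
      obtain ⟨b, a, rfl⟩ := exists_eq_of_sub_of g
      rw [Set.mem_iInter] at hg
      exact of_sub_of_mem_base_iff.2 (h1 a b fun S hS ↦ (key S a b).1 (hg ⟨S, hS⟩))
    · intro g hg
      rw [Set.mem_iInter]
      exact fun S ↦ ⟨g, hg, 0, S.2.isPrimeIdeal.zero_notMem, by simp⟩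

/-- The monoid analogue of `IsMinimalOver.isTIdeal`: a height-one prime is a `t`-ideal. A sum `w` of
maximal length of elements of the finite set that is not locally divisible by `α` gives a fraction
`t + w - α` in the inverse. -/
lemma IsHeightOnePrime.isMonoidTIdeal {S : AddSemigroupIdeal Γ} (hS : IsHeightOnePrime S) :
    IsMonoidTIdeal S := by
  refine ⟨hS.prop.2, Set.Subset.antisymm ?_ ?_⟩
  · rintro g ⟨E, hEfin, hEne, hES, hg⟩
    have hE : E ⊆ GrothendieckAddGroup.of '' (S : Set Γ) := fun e he ↦
      hES ⟨e, he, 0, zero_mem (base Γ), by simp⟩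
    obtain ⟨F₀, hF₀S, hF₀fin, rfl⟩ : ∃ F : Set Γ, F ⊆ S ∧ F.Finite ∧
        GrothendieckAddGroup.of '' F = E := Set.exists_subset_image_finite_and.1
          ⟨E, hE, hEfin, rfl⟩ |>.imp fun F h ↦ ⟨h.1, h.2.1, h.2.2.symm⟩
    obtain ⟨F, rfl⟩ := hF₀fin.exists_finset_coe
    have hF : F.Nonempty := by simpa using hEne
    obtain ⟨γ, rfl⟩ : ∃ γ, GrothendieckAddGroup.of γ = g := by
      have : g + 0 ∈ base Γ := hg 0 fun x hx ↦ by
        obtain ⟨s, -, rfl⟩ := hES hx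
        simpa using of_mem_base s
      rw [add_zero] at this
      exact mem_base.1 this
    refine ⟨γ, ?_, rfl⟩
    by_contra hγ
    obtain ⟨α, hα⟩ := hS.prop.2
    set L := locallyAboveIdeal α hS.isPrimeIdeal with hL
    have h0 : (0 : Γ) ∉ L := by
      rintro ⟨t, ht, c, h⟩
      rw [add_zero] at h
      exact ht (h ▸ (add_comm c α ▸ S.add_mem c hα))
    have hpow : ∀ e ∈ F, ∃ m : ℕ, m • e ∈ L := fun e he ↦ by
      obtain ⟨t, ht, m, c, h⟩ := hS.exists_add_nsmul_eq α (hF₀S he)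
      exact ⟨m, t, ht, c, h⟩
    choose! m hm using hpow
    obtain ⟨w, hw, hwe⟩ : ∃ w ∉ L, ∀ e ∈ F, e + w ∈ L := by
      classical
      by_contra! hcon
      have hlen : ∀ k : ℕ, ∃ ν : Γ → ℕ, ∑ e ∈ F, ν e = k ∧ ∑ e ∈ F, ν e • e ∉ L := by
        intro k
        induction k with
        | zero => exact ⟨0, by simp, by simpa using h0⟩
        | succ k ih =>
          obtain ⟨ν, hν, hνL⟩ := ih
          obtain ⟨e, he, heL⟩ := hcon _ hνL
          refine ⟨ν + Pi.single e 1, ?_, ?_⟩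
          · simp [Finset.sum_add_distrib, hν, Finset.sum_pi_single', he]
          · have : ∑ x ∈ F, (ν + Pi.single e 1 : Γ → ℕ) x • x = e + ∑ x ∈ F, ν x • x := by
              simp only [Pi.add_apply, add_nsmul, Finset.sum_add_distrib]
              rw [add_comm]
              congr 1
              rw [Finset.sum_eq_single e] <;> simp +contextual [he]
            rwa [this]
      obtain ⟨ν, hν, hνL⟩ := hlen (∑ e ∈ F, m e)
      obtain ⟨e, he, hle⟩ := Finset.exists_le_of_sum_le hF hν.ge
      refine hνL ?_
      rw [← Finset.add_sum_erase _ _ he, ← Nat.sub_add_cancel hle, add_nsmul,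
        add_right_comm]
      exact L.add_mem _ (hm e he)
    choose! t ht c hc using hwe
    have hT : ∑ e ∈ F, t e ∉ S := hS.isPrimeIdeal.sum_notMem F ht
    have hinv : GrothendieckAddGroup.of (∑ e ∈ F, t e + w) - GrothendieckAddGroup.of α ∈
        monoidInv (GrothendieckAddGroup.of '' (F : Set Γ) +
          (base Γ : Set (GrothendieckAddGroup Γ))) := by
      rintro _ ⟨_, ⟨e, he, rfl⟩, y, hy, rfl⟩
      obtain ⟨y, rfl⟩ := mem_base.1 hy
      classical
      dsimp only
      rw [← map_add, sub_add_eq_add_sub, ← map_add, of_sub_of_mem_base_iff]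
      refine ⟨∑ x ∈ F.erase e, t x + c e + y, ?_⟩
      rw [← Finset.add_sum_erase _ _ he]
      calc t e + ∑ x ∈ F.erase e, t x + w + (e + y)
          = (t e + (e + w)) + (∑ x ∈ F.erase e, t x + y) := by abel
        _ = _ := by rw [hc e he]; abel
    have := hg _ hinv
    rw [add_sub, ← map_add, of_sub_of_mem_base_iff] at this
    obtain ⟨d, hd⟩ := this
    exact hw ⟨∑ e ∈ F, t e + γ, hS.isPrimeIdeal.add_notMem hT hγ, d, by rw [← hd]; abel⟩
  · rintro _ ⟨s, hs, rfl⟩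
    refine ⟨{GrothendieckAddGroup.of s}, Set.finite_singleton _, Set.singleton_nonempty _, ?_, ?_⟩
    · rintro _ ⟨_, rfl, y, hy, rfl⟩
      obtain ⟨y, rfl⟩ := mem_base.1 hy
      exact ⟨y + s, S.add_mem y hs, by rw [map_add, add_comm]⟩
    · intro x hx
      rw [add_comm]
      exact hx _ ⟨_, rfl, 0, zero_mem (base Γ), by simp⟩

/-- In a weakly Krull monoid, proper `t`-ideals lie in height-one primes. -/
lemma IsMonoidTIdeal.exists_le_isHeightOnePrime (hΓ : IsWeaklyKrullMonoid Γ)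
    {T : AddSemigroupIdeal Γ} (hT : (T : Set Γ) ≠ Set.univ) (h : IsMonoidTIdeal T) :
    ∃ S, IsHeightOnePrime S ∧ T ≤ S := by
  obtain ⟨h1, h2⟩ := isWeaklyKrullMonoid_iff.1 hΓ
  obtain ⟨⟨a, ha⟩, hT'⟩ := h
  by_contra! hcon
  have hb : ∀ S : AddSemigroupIdeal Γ, IsHeightOnePrime S → ∃ b ∈ T, b ∉ S := fun S hS ↦
    SetLike.not_le_iff_exists.1 (hcon S hS)
  choose! b hbT hbS using hb
  set E : Set Γ := insert a (b '' {S | IsHeightOnePrime S ∧ a ∈ S}) with hE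
  have hET : E ⊆ T := by
    rintro x (rfl | ⟨S, hS, rfl⟩)
    exacts [ha, hbT S hS.1]
  -- `E + Γ` has trivial inverse, so `0` lies in its `t`-closure.
  have h0 : (0 : GrothendieckAddGroup Γ) ∈
      monoidTClosure (GrothendieckAddGroup.of '' (T : Set Γ)) := by
    refine ⟨GrothendieckAddGroup.of '' E, (((h2 a).image b).insert a).image _,
      ⟨_, a, Set.mem_insert _ _, rfl⟩, ?_, ?_⟩
    · rintro _ ⟨_, ⟨x, hx, rfl⟩, y, hy, rfl⟩
      obtain ⟨y, rfl⟩ := mem_base.1 hy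
      exact ⟨y + x, T.add_mem y (hET hx), by rw [map_add, add_comm]⟩
    · intro x hx
      rw [zero_add]
      obtain ⟨p, q, rfl⟩ := exists_eq_of_sub_of x
      have hx' : ∀ e ∈ E, ∃ c, e + p = q + c := fun e he ↦ by
        have := hx _ ⟨_, ⟨e, he, rfl⟩, 0, zero_mem (base Γ), rfl⟩
        simp only [add_zero] at this
        rwa [sub_add_eq_add_sub, ← map_add, of_sub_of_mem_base_iff, add_comm p] at this
      refine of_sub_of_mem_base_iff.2 (h1 q p fun S hS ↦ ?_)
      by_cases haS : a ∈ S
      · exact ⟨b S, hbS S hS, hx' _ (Set.mem_insert_of_mem _ ⟨S, ⟨hS, haS⟩, rfl⟩)⟩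
      · exact ⟨a, haS, hx' _ (Set.mem_insert _ _)⟩
  rw [hT'] at h0
  obtain ⟨z, hz, hz0⟩ := h0
  have : z = 0 := GrothendieckAddGroup.of_injective (by rw [hz0, map_zero])
  subst this
  exact hT (Set.eq_univ_of_forall fun x ↦ by simpa using T.add_mem x hz)

lemma isMaximalMonoidTIdeal_iff (hΓ : IsWeaklyKrullMonoid Γ) {S : AddSemigroupIdeal Γ} :
    IsMaximalMonoidTIdeal S ↔ IsHeightOnePrime S := by
  constructor
  · intro h
    obtain ⟨S', hS', hle⟩ := h.prop.2.exists_le_isHeightOnePrime hΓ h.prop.1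
    have := h.le_of_ge ⟨hS'.isPrimeIdeal.1, hS'.isMonoidTIdeal⟩ hle
    exact le_antisymm hle this ▸ hS'
  · intro hS
    refine ⟨⟨hS.isPrimeIdeal.1, hS.isMonoidTIdeal⟩, ?_⟩
    rintro T ⟨hT, hTt⟩ hle
    obtain ⟨S', hS', hle'⟩ := hTt.exists_le_isHeightOnePrime hΓ hT
    exact hle'.trans (hS'.le_of_le hS.prop (hle.trans hle'))

end WeaklyKrullMonoid

/-! ### Going up along integral extensions of the semigroup ring -/

section GoingUp

lemma exists_forall_rel_of_total {ι : Type*} {r : ι → ι → Prop} {s : Finset ι} (hs : s.Nonempty)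
    (htrans : ∀ i ∈ s, ∀ j ∈ s, ∀ k ∈ s, r i j → r j k → r i k)
    (htotal : ∀ i ∈ s, ∀ j ∈ s, r i j ∨ r j i) : ∃ i ∈ s, ∀ j ∈ s, r i j := by
  classical
  induction hs using Finset.Nonempty.cons_induction with
  | singleton a =>
    exact ⟨a, by simp, fun j hj ↦ by
      rw [Finset.mem_singleton.1 hj]
      simpa using htotal a (by simp) a (by simp)⟩
  | cons a s ha hs ih =>
    obtain ⟨i, hi, h⟩ := ih
      (fun i hi j hj k hk ↦ htrans i (by simp [hi]) j (by simp [hj]) k (by simp [hk]))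
      (fun i hi j hj ↦ htotal i (by simp [hi]) j (by simp [hj]))
    have his : i ∈ Finset.cons a s ha := by simp [hi]
    have has : a ∈ Finset.cons a s ha := by simp
    rcases htotal i his a has with h' | h'
    · refine ⟨i, his, fun j hj ↦ ?_⟩
      rcases Finset.mem_cons.1 hj with rfl | hj
      exacts [h', h j hj]
    · refine ⟨a, has, fun j hj ↦ ?_⟩
      rcases Finset.mem_cons.1 hj with rfl | hj
      · exact (htotal j has j has).elim id id
      · exact htrans a has i his j (by simp [hj]) h' (h j hj)

/-- Let `Q ≤ U` be primes of `A`, and let `B` be an integral extension of `A`. Above `Q` there is a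
prime `Q'` of `B`, contained in a prime `U'` over `U`; and any prime below `U'` which lies over `U`
is `U'` itself. -/
lemma exists_primes_over {A B : Type*} [CommRing A] [CommRing B] [Algebra A B]
    [Algebra.IsIntegral A B] (hinj : Function.Injective (algebraMap A B)) {Q U : Ideal A}
    (hQ : Q.IsPrime) (hU : U.IsPrime) (hQU : Q ≤ U) :
    ∃ Q' U' : Ideal B, Q'.IsPrime ∧ U'.IsPrime ∧ Q' ≤ U' ∧ Q'.comap (algebraMap A B) = Q ∧
      U'.comap (algebraMap A B) = U ∧ ∀ V : Ideal B, V.IsPrime → V ≤ U' →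
        U ≤ V.comap (algebraMap A B) → U' ≤ V := by
  obtain ⟨Q', -, hQ', hQ'Q⟩ := Ideal.exists_ideal_over_prime_of_isIntegral Q (⊥ : Ideal B) (by
    change RingHom.ker (algebraMap A B) ≤ Q
    rw [(RingHom.injective_iff_ker_eq_bot _).1 hinj]
    exact bot_le)
  obtain ⟨U', hle, hU', hU'U⟩ := Ideal.exists_ideal_over_prime_of_isIntegral U Q' (hQ'Q ▸ hQU)
  refine ⟨Q', U', hQ', hU', hle, hQ'Q, hU'U, fun V hV hVU hUV ↦ ?_⟩
  by_contra hn
  obtain ⟨x, hx, hxV⟩ := SetLike.not_le_iff_exists.1 hn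
  have := Ideal.comap_lt_comap_of_integral_mem_sdiff hVU ⟨hx, hxV⟩
    (Algebra.IsIntegral.isIntegral (R := A) x)
  rw [hU'U] at this
  exact absurd hUV this.not_ge

end GoingUp

section Valuation

open Polynomial

/-- The `u`, `u⁻¹` lemma: if `E` is integrally closed in the field `K` and `x ∈ K` is a root of a
polynomial over `E` not all of whose coefficients are in the prime `M`, then `x` or its inverse
lies in `E_M`. -/
lemma exists_mul_eq_of_aeval_eq_zero {E K : Type*} [CommRing E] [Field K] [Algebra E K]
    (hinj : Function.Injective (algebraMap E K))
    (hE : ∀ x : K, IsIntegral E x → ∃ y, algebraMap E K y = x) {M : Ideal E} (x : K)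
    (p : E[X]) (hp : aeval x p = 0) (hpM : ∃ n, p.coeff n ∉ M) :
    ∃ y z : E, y ∉ M ∧ (algebraMap E K y * x = algebraMap E K z ∨
      algebraMap E K z * x = algebraMap E K y) := by
  induction hn : p.natDegree using Nat.strong_induction_on generalizing p with
  | _ n ih =>
    obtain ⟨k, hk⟩ := hpM
    -- The leading coefficient times `x` is integral, so it lies in `E`.
    obtain ⟨z, hz⟩ := hE _ (isIntegral_leadingCoeff_smul p x hp)
    rw [Algebra.smul_def] at hz
    by_cases haM : p.leadingCoeff ∈ M
    swap
    · exact ⟨_, z, haM, .inl hz.symm⟩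
    by_cases hzM : z ∈ M
    swap
    · exact ⟨z, _, hzM, .inr hz.symm⟩
    -- Otherwise the degree can be lowered without changing the coefficients modulo `M`.
    obtain ⟨m, rfl⟩ : ∃ m, n = m + 1 := by
      refine Nat.exists_eq_succ_of_ne_zero ?_
      rintro rfl
      rw [eq_C_of_natDegree_eq_zero hn, aeval_C] at hp
      rw [eq_C_of_natDegree_eq_zero hn, hinj (hp.trans (map_zero _).symm)] at hk
      simp at hk
    refine ih (p.eraseLead + C z * X ^ m).natDegree ?_ (p.eraseLead + C z * X ^ m) ?_ ⟨k, ?_⟩ rfl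
    · have h1 : p.eraseLead.natDegree ≤ m := (eraseLead_natDegree_le p).trans (by omega)
      exact Nat.lt_succ_of_le (natDegree_add_le_of_degree_le h1 (natDegree_C_mul_X_pow_le z m))
    · rw [← eraseLead_add_monomial_natDegree_leadingCoeff p, map_add, aeval_monomial, hn] at hp
      rw [map_add, map_mul, aeval_C, map_pow, aeval_X, hz]
      linear_combination hp
    · intro hmem
      refine hk ?_
      rw [coeff_add, eraseLead_coeff, coeff_C_mul_X_pow] at hmem
      by_cases hkn : k = p.natDegree
      · rw [hkn]
        exact haM
      · rw [if_neg hkn] at hmem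
        refine (Ideal.add_mem_iff_left M ?_).1 hmem
        split_ifs
        exacts [hzM, zero_mem _]

end Valuation

/-! ### The ideals `P[Γ]` have height one -/

section CoeffIdealHeight

open AddMonoidAlgebra

variable {D Γ : Type*} [CommRing D] [AddCommMonoid Γ]

lemma isIntegral_mapRingHom {E : Type*} [CommRing E] [Algebra D E] [Algebra.IsIntegral D E] :
    (mapRingHom Γ (algebraMap D E)).IsIntegral := by
  let _ : Algebra (AddMonoidAlgebra D Γ) (AddMonoidAlgebra E Γ) :=
    (AddMonoidAlgebra.mapRingHom Γ (algebraMap D E)).toAlgebra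
  have hmap : algebraMap (AddMonoidAlgebra D Γ) (AddMonoidAlgebra E Γ) =
    AddMonoidAlgebra.mapRingHom Γ (algebraMap D E) := rfl
  intro f
  change IsIntegral (AddMonoidAlgebra D Γ) f
  refine AddMonoidAlgebra.induction_linear f isIntegral_zero (fun _ _ ↦ IsIntegral.add)
    fun γ e ↦ ?_
  have h1 : IsIntegral (AddMonoidAlgebra D Γ) (single γ (1 : E)) := by
    have : single γ (1 : E) = algebraMap (AddMonoidAlgebra D Γ) _ (single γ 1) := by simp [hmap]
    exact this ▸ isIntegral_algebraMap
  have h2 : IsIntegral (AddMonoidAlgebra D Γ) (single (0 : Γ) e) :=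
    (Algebra.IsIntegral.isIntegral (R := D) e).map_of_comp_eq
      (singleZeroRingHom : D →+* AddMonoidAlgebra D Γ)
      (singleZeroRingHom : E →+* AddMonoidAlgebra E Γ) (by ext; simp [hmap])
  simpa using h1.mul h2

/-- Over a weakly Krull UMT-domain, `P[Γ]` has height one. A nonzero prime `Q < P[Γ]` would meet `D`
trivially. It lies under a prime `Q'` of `E[Γ]`, where `E` is the integral closure of `D`, and
`Q' ≤ M[Γ]` for a prime `M` over `P`. As `E_M` is a valuation ring, an element of `Q` can be
rescaled to have a coefficient outside `M`. -/
theorem IsHeightOne.isHeightOne_coeffIdeal [IsDomain D] [UniqueSums Γ]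
    (hD : IsWeaklyKrullDomain D) (hUMT : IsUMTDomain D) {P : Ideal D} (hP : IsHeightOne P) :
    IsHeightOne (coeffIdeal Γ P) := by
  refine ⟨⟨isPrime_coeffIdeal hP.isPrime, coeffIdeal_ne_bot hP.ne_bot⟩, ?_⟩
  rintro Q ⟨hQ, hQ0⟩ hQP
  by_cases hQD : ∃ d ∈ Q.comap (singleZeroRingHom : D →+* AddMonoidAlgebra D Γ), d ≠ 0
  · have hle : Q.comap (singleZeroRingHom : D →+* AddMonoidAlgebra D Γ) ≤ P := fun d hd ↦
      single_mem_coeffIdeal.1 (hQP hd)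
    have heq := hP.eq_of_le (Ideal.comap_isPrime _ _)
      ((Submodule.ne_bot_iff _).2 hQD) hle
    exact coeffIdeal_le fun d hd ↦ by
      rw [← heq] at hd
      exact hd
  exfalso
  push Not at hQD
  obtain ⟨f, hf, hf0⟩ := Submodule.exists_mem_ne_zero_of_ne_bot hQ0
  let K := FractionRing D
  let E := integralClosure D K
  have hDE : Function.Injective (algebraMap D E) := by
    have : Function.Injective (algebraMap D K) := IsFractionRing.injective D K
    rw [IsScalarTower.algebraMap_eq D E K] at this
    exact Function.Injective.of_comp (f := algebraMap E K) this
  have hEK : Function.Injective (algebraMap E K) := Subtype.val_injective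
  let _ : Algebra (AddMonoidAlgebra D Γ) (AddMonoidAlgebra E Γ) :=
    (AddMonoidAlgebra.mapRingHom Γ (algebraMap D E)).toAlgebra
  have hmap : algebraMap (AddMonoidAlgebra D Γ) (AddMonoidAlgebra E Γ) =
    AddMonoidAlgebra.mapRingHom Γ (algebraMap D E) := rfl
  have hint : Algebra.IsIntegral (AddMonoidAlgebra D Γ) (AddMonoidAlgebra E Γ) :=
    ⟨isIntegral_mapRingHom⟩
  obtain ⟨Q', U', hQ', hU', hQU', hQ'Q, hU'P, hmin⟩ := exists_primes_over
    (B := AddMonoidAlgebra E Γ) (AddMonoidAlgebra.map_injective _ hDE) hQ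
    (isPrime_coeffIdeal hP.isPrime) hQP
  let M : Ideal E := U'.comap (singleZeroRingHom : E →+* AddMonoidAlgebra E Γ)
  have hM : M.IsPrime := Ideal.comap_isPrime _ _
  have hMP : ∀ d : D, algebraMap D E d ∈ M ↔ d ∈ P := by
    intro d
    have : single (0 : Γ) d ∈ U'.comap (algebraMap _ (AddMonoidAlgebra E Γ)) ↔ d ∈ P := by
      rw [hU'P, single_mem_coeffIdeal]
    rw [← this, Ideal.mem_comap (x := single 0 d), hmap, mapRingHom_single]
    rfl
  have hU'M : U' ≤ coeffIdeal Γ M := by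
    refine hmin _ (isPrime_coeffIdeal hM) (coeffIdeal_le fun e he ↦ he) ?_
    refine coeffIdeal_le fun d hd ↦ ?_
    rw [Ideal.mem_comap, hmap, mapRingHom_single]
    exact single_mem_coeffIdeal.2 ((hMP d).2 hd)
  -- Coefficients of `f` are comparable in the valuation ring `E_M`.
  obtain ⟨γ₀, hγ₀, hmin₀⟩ := exists_forall_rel_of_total (s := f.coeff.support)
    (r := fun γ δ ↦ ∃ y z : E, y ∉ M ∧
      y * algebraMap D E (f.coeff δ) = z * algebraMap D E (f.coeff γ))
    (Finsupp.support_nonempty_iff.2 (by simpa using hf0))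
    (by
      rintro i - j - k - ⟨y, z, hy, h⟩ ⟨y', z', hy', h'⟩
      exact ⟨y * y', z * z', fun hm ↦ (hM.mem_or_mem hm).elim hy hy', by
        linear_combination y * h' + z' * h⟩)
    (by
      intro i hi j hj
      have hi0 : algebraMap D K (f.coeff i) ≠ 0 := by simpa using Finsupp.mem_support_iff.1 hi
      obtain ⟨p, hp, n, hn⟩ := hUMT.exists_aeval_eq_zero hD hP
        (algebraMap D K (f.coeff j) / algebraMap D K (f.coeff i))
      obtain ⟨y, z, hy, h⟩ := exists_mul_eq_of_aeval_eq_zero hEK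
        (fun x hx ↦ ⟨⟨x, isIntegral_trans (A := E) x hx⟩, rfl⟩) (M := M)
        (algebraMap D K (f.coeff j) / algebraMap D K (f.coeff i)) (p.map (algebraMap D E))
        (by rwa [Polynomial.aeval_map_algebraMap]) ⟨n, by rwa [Polynomial.coeff_map, hMP]⟩
      have hcast : ∀ d : D, algebraMap D K d = algebraMap E K (algebraMap D E d) :=
        fun d ↦ IsScalarTower.algebraMap_apply D E K d
      rcases h with h | h
      · refine .inl ⟨y, z, hy, hEK ?_⟩
        rw [map_mul, map_mul, ← hcast, ← hcast, ← h, mul_assoc, div_mul_cancel₀ _ hi0]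
      · refine .inr ⟨y, z, hy, hEK ?_⟩
        rw [map_mul, map_mul, ← hcast, ← hcast, ← h, mul_assoc, div_mul_cancel₀ _ hi0])
  choose! y z hy hyz using hmin₀
  have hd₀ : f.coeff γ₀ ≠ 0 := Finsupp.mem_support_iff.1 hγ₀
  classical
  set F := f.coeff.support with hF
  let f' : AddMonoidAlgebra E Γ := ∑ γ ∈ F, single γ ((∏ δ ∈ F.erase γ, y δ) * z γ)
  have hf' : single 0 (algebraMap D E (f.coeff γ₀)) * f' =
      single 0 (∏ δ ∈ F, y δ) * algebraMap (AddMonoidAlgebra D Γ) (AddMonoidAlgebra E Γ) f := by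
    conv_rhs => rw [← AddMonoidAlgebra.sum_coeff_single f, Finsupp.sum, map_sum]
    rw [Finset.mul_sum, Finset.mul_sum]
    refine Finset.sum_congr rfl fun γ hγ ↦ ?_
    rw [hmap, mapRingHom_single, single_mul_single, single_mul_single,
      ← Finset.mul_prod_erase F y hγ]
    congr 1
    linear_combination (-∏ δ ∈ F.erase γ, y δ) * hyz γ hγ
  have hf'Q : f' ∈ Q' := by
    have : single 0 (algebraMap D E (f.coeff γ₀)) * f' ∈ Q' := by
      rw [hf']
      refine Ideal.mul_mem_left _ _ ?_
      rw [← Ideal.mem_comap, hQ'Q]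
      exact hf
    refine (hQ'.mem_or_mem this).resolve_left fun hmem ↦ hd₀ (hQD _ ?_)
    rw [← hQ'Q]
    simpa [hmap] using hmem
  have hcoeff : f'.coeff γ₀ = ∏ δ ∈ F, y δ := by
    have hz : z γ₀ = y γ₀ := by
      have h0 : algebraMap D E (f.coeff γ₀) ≠ 0 := fun h ↦ hd₀ (hDE (by rw [h, map_zero]))
      exact (mul_right_cancel₀ h0 (hyz γ₀ hγ₀)).symm
    simp only [f', coeff_sum, Finsupp.coe_finsetSum, Finset.sum_apply, coeff_single]
    rw [Finset.sum_eq_single γ₀, Finsupp.single_eq_same, hz, Finset.prod_erase_mul F y hγ₀]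
    · intro γ _ hne
      exact Finsupp.single_eq_of_ne hne.symm
    · exact fun h ↦ absurd hγ₀ h
  have := hU'M (hQU' hf'Q) γ₀
  rw [hcoeff, Ideal.IsPrime.prod_mem_iff (hp := hM)] at this
  obtain ⟨δ, hδ, h⟩ := this
  exact hy δ hδ h

end CoeffIdealHeight

/-! ### The ideals `D[S]` have height one -/

section ExponentIdealHeight

open AddMonoidAlgebra
open Algebra (GrothendieckAddGroup)

variable {D Γ : Type*} [CommRing D] [AddCommMonoid Γ]

variable (Γ) in
/-- The inclusion of `Γ` into its root closure. -/
def toRootClosure : Γ →+ rootClosure Γ where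
  toFun γ := ⟨GrothendieckAddGroup.of γ, 1, le_rfl, by simpa using of_mem_base γ⟩
  map_zero' := Subtype.ext (map_zero _)
  map_add' _ _ := Subtype.ext (map_add _ _ _)

lemma coe_toRootClosure (γ : Γ) :
    (toRootClosure Γ γ : GrothendieckAddGroup Γ) = GrothendieckAddGroup.of γ := rfl

lemma exists_nsmul_eq_toRootClosure (g : rootClosure Γ) :
    ∃ n : ℕ, 1 ≤ n ∧ ∃ γ, n • g = toRootClosure Γ γ := by
  obtain ⟨g, n, hn, hg⟩ := g
  obtain ⟨γ, hγ⟩ := mem_base.1 hg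
  exact ⟨n, hn, γ, Subtype.ext hγ.symm⟩

lemma isIntegral_mapDomainRingHom :
    (mapDomainRingHom D (toRootClosure Γ)).IsIntegral := by
  let _ : Algebra (AddMonoidAlgebra D Γ) (AddMonoidAlgebra D (rootClosure Γ)) :=
    (mapDomainRingHom D (toRootClosure Γ)).toAlgebra
  have hmap : algebraMap (AddMonoidAlgebra D Γ) (AddMonoidAlgebra D (rootClosure Γ)) =
    mapDomainRingHom D (toRootClosure Γ) := rfl
  intro f
  change IsIntegral (AddMonoidAlgebra D Γ) f
  refine AddMonoidAlgebra.induction_linear f isIntegral_zero (fun _ _ ↦ IsIntegral.add)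
    fun g d ↦ ?_
  have h1 : IsIntegral (AddMonoidAlgebra D Γ) (single g (1 : D)) := by
    obtain ⟨n, hn, γ, h⟩ := exists_nsmul_eq_toRootClosure g
    refine IsIntegral.of_pow (n := n) hn ?_
    have : single g (1 : D) ^ n = algebraMap (AddMonoidAlgebra D Γ) _ (single γ 1) := by
      simp [hmap, single_pow, h]
    exact this ▸ isIntegral_algebraMap
  have h2 : IsIntegral (AddMonoidAlgebra D Γ) (single (0 : rootClosure Γ) d) := by
    have : single (0 : rootClosure Γ) d = algebraMap (AddMonoidAlgebra D Γ) _ (single 0 d) := by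
      simp [hmap]
    exact this ▸ isIntegral_algebraMap
  simpa using h1.mul h2

variable [IsCancelAdd Γ]

lemma toRootClosure_injective : Function.Injective (toRootClosure Γ) := fun _ _ h ↦
  GrothendieckAddGroup.of_injective (congrArg Subtype.val h)

/-- The radical of `S` in the root closure of `Γ`. -/
def rootIdeal (S : AddSemigroupIdeal Γ) : AddSemigroupIdeal (rootClosure Γ) where
  carrier := {g | ∃ n : ℕ, 1 ≤ n ∧ ∃ s ∈ S, n • g = toRootClosure Γ s}
  vadd_mem' := by
    rintro h g ⟨n, hn, s, hs, hg⟩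
    obtain ⟨m, hm, η, hη⟩ := exists_nsmul_eq_toRootClosure h
    obtain ⟨k, rfl⟩ := Nat.exists_eq_add_of_le hm
    refine ⟨n * (1 + k), Nat.mul_pos hn hm, (n • η + k • s) + s, S.add_mem _ hs, ?_⟩
    rw [vadd_eq_add, nsmul_add, mul_nsmul' h, hη, mul_nsmul g, hg, ← map_nsmul, ← map_nsmul,
      ← map_add, add_nsmul, one_nsmul]
    congr 1
    abel

lemma IsPrimeIdeal.toRootClosure_mem_rootIdeal {S : AddSemigroupIdeal Γ} (hS : IsPrimeIdeal S)
    {γ : Γ} : toRootClosure Γ γ ∈ rootIdeal S ↔ γ ∈ S := by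
  constructor
  · rintro ⟨n, -, s, hs, h⟩
    by_contra hγ
    rw [← map_nsmul] at h
    exact hS.nsmul_notMem hγ n (toRootClosure_injective h ▸ hs)
  · exact fun h ↦ ⟨1, le_rfl, γ, h, one_nsmul _⟩

lemma IsPrimeIdeal.isPrimeIdeal_rootIdeal {S : AddSemigroupIdeal Γ} (hS : IsPrimeIdeal S) :
    IsPrimeIdeal (rootIdeal S) := by
  constructor
  · intro h
    have : toRootClosure Γ 0 ∈ (rootIdeal S : Set (rootClosure Γ)) := h ▸ Set.mem_univ _
    exact hS.zero_notMem (hS.toRootClosure_mem_rootIdeal.1 this)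
  · rintro a b ⟨n, hn, s, hs, h⟩
    obtain ⟨m, hm, α, hα⟩ := exists_nsmul_eq_toRootClosure a
    obtain ⟨k, hk, β, hβ⟩ := exists_nsmul_eq_toRootClosure b
    have hsum : (k * n) • α + (m * n) • β = (m * k) • s := toRootClosure_injective (by
      rw [map_add, map_nsmul, map_nsmul, map_nsmul, ← h, ← hα, ← hβ]
      simp only [nsmul_add, ← mul_nsmul]
      congr 2 <;> ring)
    by_contra! hn'
    have hmem : ∀ {x : rootClosure Γ} {l : ℕ} {ξ : Γ}, 1 ≤ l → l • x = toRootClosure Γ ξ →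
        x ∉ rootIdeal S → ξ ∉ S := fun hl h hx hξ ↦ hx ⟨_, hl, _, hξ, h⟩
    refine hS.add_notMem (hS.nsmul_notMem (hmem hm hα hn'.1) (k * n))
      (hS.nsmul_notMem (hmem hk hβ hn'.2) (m * n)) ?_
    rw [hsum]
    obtain ⟨l, hl⟩ := Nat.exists_eq_add_of_le (Nat.mul_pos hm hk)
    rw [hl, add_nsmul, add_comm, one_nsmul]
    exact S.add_mem _ hs

/-- If the localization of the root closure at the height-one prime `S` is a valuation monoid, then
`D[S]` has height one. A nonzero prime `Q < D[S]` would contain no `X ^ γ`. It lies under a prime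
`Q'` of `D[Γ']`, with `Γ'` the root closure, and the only prime over `D[S]` is given by the radical
`S'` of `S`, so `Q' ≤ D[S']`. Dividing an element of `Q` by a monomial of least value gives an
element of `Q'` with an exponent outside `S'`. -/
theorem IsHeightOnePrime.isHeightOne_exponentIdeal [IsDomain D] [IsAddTorsionFree Γ]
    {S : AddSemigroupIdeal Γ} (hS : IsHeightOnePrime S)
    (hval : IsValuationMonoid (localizationAt (rootClosure Γ) S)) :
    IsHeightOne (exponentIdeal D S) := by
  have hSp := hS.isPrimeIdeal
  refine ⟨⟨isPrime_exponentIdeal hSp, exponentIdeal_ne_bot hS.prop.2⟩, ?_⟩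
  rintro Q ⟨hQ, hQ0⟩ hQS
  by_cases hQX : ∃ γ, single γ (1 : D) ∈ Q
  · have hTS : exponentsOf Q ≤ S := fun γ hγ ↦
      (single_mem_exponentIdeal one_ne_zero).1 (hQS hγ)
    exact exponentIdeal_le fun γ hγ ↦ hS.le_of_le ⟨isPrimeIdeal_exponentsOf hQ, hQX⟩ hTS hγ
  exfalso
  push Not at hQX
  obtain ⟨f, hf, hf0⟩ := Submodule.exists_mem_ne_zero_of_ne_bot hQ0
  let _ : Algebra (AddMonoidAlgebra D Γ) (AddMonoidAlgebra D (rootClosure Γ)) :=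
    (mapDomainRingHom D (toRootClosure Γ)).toAlgebra
  have hmap : ∀ γ d, algebraMap (AddMonoidAlgebra D Γ) (AddMonoidAlgebra D (rootClosure Γ))
    (single γ d) = single (toRootClosure Γ γ) d := fun γ d ↦ mapDomain_single
  have hint : Algebra.IsIntegral (AddMonoidAlgebra D Γ) (AddMonoidAlgebra D (rootClosure Γ)) :=
    ⟨isIntegral_mapDomainRingHom⟩
  have : IsAddTorsionFree (rootClosure Γ) := isAddTorsionFree_addSubmonoid _
  obtain ⟨Q', U', hQ', hU', hQU', hQ'Q, hU'S, hmin⟩ := exists_primes_over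
    (B := AddMonoidAlgebra D (rootClosure Γ)) (mapDomain_injective toRootClosure_injective) hQ
    (isPrime_exponentIdeal hSp) hQS
  have hU'le : U' ≤ exponentIdeal D (rootIdeal S) := by
    refine hmin _ (isPrime_exponentIdeal hSp.isPrimeIdeal_rootIdeal) ?_ ?_
    · refine exponentIdeal_le ?_
      rintro g ⟨n, hn, s, hs, h⟩
      refine hU'.mem_of_pow_mem n ?_
      rw [single_pow, one_pow, h, ← hmap, ← Ideal.mem_comap, hU'S]
      exact (single_mem_exponentIdeal one_ne_zero).2 hs
    · refine exponentIdeal_le fun γ hγ ↦ ?_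
      rw [Ideal.mem_comap, hmap]
      exact (single_mem_exponentIdeal one_ne_zero).2 (hSp.toRootClosure_mem_rootIdeal.2 hγ)
  have hV := (isValuationMonoid_localizationAt_iff hSp).1 hval
  obtain ⟨γ₀, hγ₀, hmin₀⟩ := exists_forall_rel_of_total (s := f.coeff.support)
    (r := fun γ δ ↦ GrothendieckAddGroup.of δ - GrothendieckAddGroup.of γ ∈
      localizationAt (rootClosure Γ) S)
    (Finsupp.support_nonempty_iff.2 (by simpa using hf0))
    (by
      rintro i - j - k - ⟨x, hx, s, hs, h⟩ ⟨x', hx', s', hs', h'⟩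
      refine ⟨x + x', add_mem hx hx', s + s', hSp.add_notMem hs hs', ?_⟩
      rw [← sub_add_sub_cancel', h, h', map_add]
      abel)
    (by
      intro i _ j _
      have := hV (GrothendieckAddGroup.of j - GrothendieckAddGroup.of i)
      rwa [neg_sub] at this)
  simp only [localizationAt, Set.mem_ofPred_eq] at hmin₀
  choose! x hx s hs hxs using hmin₀
  classical
  set F := f.coeff.support with hF
  -- `η γ` stands for `γ - γ₀ + ∑ s`, an element of the root closure.
  let η : Γ → rootClosure Γ := fun γ ↦ if h : γ ∈ F then
    ⟨x γ, hx γ h⟩ + toRootClosure Γ (∑ δ ∈ F.erase γ, s δ) else 0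
  have hη : ∀ γ ∈ F, toRootClosure Γ γ₀ + η γ = toRootClosure Γ (∑ δ ∈ F, s δ + γ) := by
    intro γ hγ
    apply Subtype.ext
    simp only [η, dif_pos hγ, AddSubmonoid.coe_add, coe_toRootClosure]
    rw [← Finset.add_sum_erase F s hγ, map_add, map_add, ← sub_add_cancel (x γ)
      (GrothendieckAddGroup.of (s γ)), ← hxs γ hγ]
    abel
  let f' : AddMonoidAlgebra D (rootClosure Γ) := ∑ γ ∈ F, single (η γ) (f.coeff γ)
  have hf' : single (toRootClosure Γ γ₀) 1 * f' =
      algebraMap (AddMonoidAlgebra D Γ) _ (single (∑ δ ∈ F, s δ) 1 * f) := by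
    conv_rhs => rw [← AddMonoidAlgebra.sum_coeff_single f, Finsupp.sum, Finset.mul_sum, map_sum]
    rw [Finset.mul_sum]
    refine Finset.sum_congr rfl fun γ hγ ↦ ?_
    rw [single_mul_single, single_mul_single, hmap, hη γ hγ]
  have hf'Q : f' ∈ Q' := by
    have hmem : single (toRootClosure Γ γ₀) 1 * f' ∈ Q' := by
      rw [hf', ← Ideal.mem_comap, hQ'Q]
      exact Ideal.mul_mem_left _ _ hf
    refine (hQ'.mem_or_mem hmem).resolve_left fun hmem ↦ hQX γ₀ ?_
    rwa [← hmap, ← Ideal.mem_comap, hQ'Q] at hmem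
  have hη₀ : η γ₀ = toRootClosure Γ (∑ δ ∈ F, s δ) := by
    have h := hη γ₀ hγ₀
    rw [add_comm _ γ₀, map_add] at h
    exact Subtype.ext (add_left_cancel (congrArg Subtype.val h))
  have hcoeff : f'.coeff (η γ₀) = f.coeff γ₀ := by
    simp only [f', coeff_sum, Finsupp.coe_finsetSum, Finset.sum_apply, coeff_single]
    rw [Finset.sum_eq_single γ₀, Finsupp.single_eq_same]
    · intro γ hγ hne
      refine Finsupp.single_eq_of_ne fun h ↦ hne ?_
      have h1 := hη γ hγ
      rw [← h, hη γ₀ hγ₀] at h1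
      exact (add_left_cancel (toRootClosure_injective h1)).symm
    · exact fun h ↦ absurd hγ₀ h
  have := mem_exponentIdeal.1 (hU'le (hQU' hf'Q)) (η γ₀) (by
    rw [hcoeff]
    exact Finsupp.mem_support_iff.1 hγ₀)
  rw [hη₀, hSp.toRootClosure_mem_rootIdeal] at this
  exact hSp.sum_notMem F hs this

end ExponentIdealHeight

/-! ### The group ring `K[G]` as a localization of `D[Γ]` -/

section GroupRing

open AddMonoidAlgebra
open Algebra (GrothendieckAddGroup)

variable (D Γ : Type*) [CommRing D] [AddCommMonoid Γ]

/-- The multiplicative set of the nonzero monomials of `D[Γ]`. -/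
def monomials [IsDomain D] : Submonoid (AddMonoidAlgebra D Γ) where
  carrier := {f | ∃ γ d, d ≠ 0 ∧ f = single γ d}
  one_mem' := ⟨0, 1, one_ne_zero, rfl⟩
  mul_mem' := by
    rintro _ _ ⟨γ, d, hd, rfl⟩ ⟨δ, e, he, rfl⟩
    exact ⟨γ + δ, d * e, mul_ne_zero hd he, single_mul_single ..⟩

variable (K : Type*) [Field K] [Algebra D K]

/-- The canonical homomorphism `D[Γ] → K[G]`. -/
noncomputable def toGroupRing :
    AddMonoidAlgebra D Γ →+* AddMonoidAlgebra K (GrothendieckAddGroup Γ) :=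
  (mapDomainRingHom K (GrothendieckAddGroup.of (M := Γ))).comp (mapRingHom Γ (algebraMap D K))

variable {D Γ}

lemma toGroupRing_single (γ : Γ) (d : D) :
    toGroupRing D Γ K (single γ d) = single (GrothendieckAddGroup.of γ) (algebraMap D K d) := by
  simp [toGroupRing]
  rfl

variable [IsCancelAdd Γ] [IsFractionRing D K]

lemma toGroupRing_injective : Function.Injective (toGroupRing D Γ K) :=
  (mapDomain_injective GrothendieckAddGroup.of_injective).comp
    (map_injective _ (IsFractionRing.injective D K))

variable [IsDomain D]

lemma isLocalization_toGroupRing :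
    letI := (toGroupRing D Γ K).toAlgebra
    IsLocalization (monomials D Γ) (AddMonoidAlgebra K (GrothendieckAddGroup Γ)) := by
  let _ := (toGroupRing D Γ K).toAlgebra
  have hmap : ∀ f, algebraMap (AddMonoidAlgebra D Γ)
    (AddMonoidAlgebra K (GrothendieckAddGroup Γ)) f = toGroupRing D Γ K f := fun _ ↦ rfl
  have hD : ∀ d : D, d ≠ 0 → algebraMap D K d ≠ 0 := fun d hd ↦ by simpa using hd
  refine ⟨⟨?_, ?_, ?_⟩⟩
  · rintro ⟨_, γ, d, hd, rfl⟩
    rw [hmap, toGroupRing_single]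
    refine IsUnit.of_mul_eq_one (single (-GrothendieckAddGroup.of γ) (algebraMap D K d)⁻¹) ?_
    rw [single_mul_single, add_neg_cancel, mul_inv_cancel₀ (hD d hd)]
    rfl
  · intro z
    refine AddMonoidAlgebra.induction_linear z ⟨⟨0, 1⟩, by simp⟩ ?_ ?_
    · rintro x y ⟨⟨f, m⟩, hf⟩ ⟨⟨g, n⟩, hg⟩
      refine ⟨⟨f * n + g * m, m * n⟩, ?_⟩
      simp only [Submonoid.coe_mul, map_mul, map_add] at hf hg ⊢
      rw [← hf, ← hg]
      ring
    · intro g k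
      obtain ⟨a, b, rfl⟩ := exists_eq_of_sub_of g
      obtain ⟨x, y, hy, rfl⟩ := IsFractionRing.div_surjective (A := D) k
      have hy0 := nonZeroDivisors.ne_zero hy
      refine ⟨⟨single a x, ⟨single b y, b, y, hy0, rfl⟩⟩, ?_⟩
      simp only [hmap, toGroupRing_single, single_mul_single, sub_add_cancel,
        div_mul_cancel₀ _ (hD y hy0)]
  · intro f g h
    exact ⟨1, by rw [toGroupRing_injective K h]⟩

end GroupRing

/-! ### Height-one primes of `D[Γ]` meeting the monomials -/

section Classification

open AddMonoidAlgebra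

variable {D Γ : Type*} [CommRing D] [AddCommMonoid Γ] [UniqueSums Γ]

lemma IsHeightOne.exists_eq_coeffIdeal {Q : Ideal (AddMonoidAlgebra D Γ)} (hQ : IsHeightOne Q)
    {d : D} (hd : d ≠ 0) (hdQ : single 0 d ∈ Q) : ∃ P, IsHeightOne P ∧ Q = coeffIdeal Γ P := by
  have hprime := hQ.isPrime
  set P := Q.comap (singleZeroRingHom : D →+* AddMonoidAlgebra D Γ) with hP
  have hP' : P.IsPrime := Ideal.comap_isPrime _ _
  have hP0 : P ≠ ⊥ := (Submodule.ne_bot_iff _).2 ⟨d, hdQ, hd⟩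
  have heq : ∀ P' : Ideal D, P'.IsPrime → P' ≠ ⊥ → P' ≤ P → coeffIdeal Γ P' = Q :=
    fun P' h h0 hle ↦ hQ.eq_of_le (isPrime_coeffIdeal h) (coeffIdeal_ne_bot h0)
      (coeffIdeal_le fun d hd ↦ hle hd)
  refine ⟨P, ⟨⟨hP', hP0⟩, ?_⟩, (heq P hP' hP0 le_rfl).symm⟩
  rintro P' ⟨h, h0⟩ hle
  rw [coeffIdeal_injective ((heq P' h h0 hle).trans (heq P hP' hP0 le_rfl).symm)]

lemma IsHeightOne.exists_eq_exponentIdeal [IsDomain D] {Q : Ideal (AddMonoidAlgebra D Γ)}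
    (hQ : IsHeightOne Q) {γ : Γ} (hγ : single γ 1 ∈ Q) :
    ∃ S, IsHeightOnePrime S ∧ Q = exponentIdeal D S := by
  have hS := isPrimeIdeal_exponentsOf hQ.isPrime
  have heq : ∀ S' : AddSemigroupIdeal Γ, IsPrimeIdeal S' → (S' : Set Γ).Nonempty →
      S' ≤ exponentsOf Q → exponentIdeal D S' = Q :=
    fun S' h h0 hle ↦ hQ.eq_of_le (isPrime_exponentIdeal h) (exponentIdeal_ne_bot h0)
      (exponentIdeal_le fun γ hγ ↦ hle hγ)
  refine ⟨exponentsOf Q, ⟨⟨hS, γ, hγ⟩, ?_⟩, (heq _ hS ⟨γ, hγ⟩ le_rfl).symm⟩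
  rintro S' ⟨h, h0⟩ hle
  rw [exponentIdeal_injective ((heq S' h h0 hle).trans (heq _ hS ⟨γ, hγ⟩ le_rfl).symm)]

end Classification

/-! ### Ascent to the semigroup ring -/

section Ascent

open AddMonoidAlgebra
open Algebra (GrothendieckAddGroup)

variable {D K Γ : Type*} [CommRing D] [IsDomain D] [Field K] [Algebra D K] [IsFractionRing D K]
  [AddCommMonoid Γ] [IsCancelAdd Γ] [IsAddTorsionFree Γ]

/-- The ring `D[Γ]` is the intersection of `K[G]` with the localizations at the primes `P[Γ]` and
`D[S]`, by primary decomposition of monomials, and its height-one primes are those of `K[G]`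
together with the `P[Γ]` and the `D[S]`. -/
theorem isWeaklyKrullDomain_addMonoidAlgebra (hD : IsWeaklyKrullDomain D) (hDt : IsUMTDomain D)
    (hΓ : IsWeaklyKrullMonoid Γ) (hΓt : IsUMTMonoid Γ)
    (hK : IsWeaklyKrullDomain (AddMonoidAlgebra K (GrothendieckAddGroup Γ))) :
    IsWeaklyKrullDomain (AddMonoidAlgebra D Γ) := by
  let _ := (toGroupRing D Γ K).toAlgebra
  have hmap : ∀ f, algebraMap (AddMonoidAlgebra D Γ)
    (AddMonoidAlgebra K (GrothendieckAddGroup Γ)) f = toGroupRing D Γ K f := fun _ ↦ rfl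
  have hloc := isLocalization_toGroupRing (D := D) (Γ := Γ) K
  have hinj := toGroupRing_injective (D := D) (Γ := Γ) K
  have hPht : ∀ P : Ideal D, IsHeightOne P → IsHeightOne (coeffIdeal Γ P) :=
    fun P hP ↦ hP.isHeightOne_coeffIdeal hD hDt
  have hSht : ∀ S : AddSemigroupIdeal Γ, IsHeightOnePrime S → IsHeightOne (exponentIdeal D S) :=
    fun S hS ↦ hS.isHeightOne_exponentIdeal (hΓt S ((isMaximalMonoidTIdeal_iff hΓ).2 hS))
  obtain ⟨hD1, hD2⟩ := isWeaklyKrullDomain_iff.1 hD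
  obtain ⟨hΓ1, hΓ2⟩ := isWeaklyKrullMonoid_iff.1 hΓ
  obtain ⟨hK1, hK2⟩ := isWeaklyKrullDomain_iff.1 hK
  refine isWeaklyKrullDomain_iff.2 ⟨fun a b ha hab ↦ ?_, fun f hf ↦ ?_⟩
  · have hφa : toGroupRing D Γ K a ≠ 0 := fun h ↦ ha (hinj (by rw [h, map_zero]))
    obtain ⟨z, hz⟩ := hK1 (toGroupRing D Γ K a) (toGroupRing D Γ K b) hφa fun Q hQ ↦ by
      obtain ⟨s, hs, hdvd⟩ := hab _ (hQ.comap_of_isLocalization (monomials D Γ))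
      exact ⟨toGroupRing D Γ K s, hs, by rw [← map_mul]; exact map_dvd _ hdvd⟩
    obtain ⟨⟨h, ⟨_, γ, d, hd, rfl⟩⟩, hzh⟩ := IsLocalization.surj (monomials D Γ) z
    have hbh : b * single γ d = a * h := hinj (by
      simp only [hmap] at hzh
      rw [map_mul, map_mul, hz, mul_assoc, hzh])
    -- It remains to see that the denominator `single γ d` of `b / a` divides the numerator `h`.
    suffices hdvd : single γ d ∣ h by
      obtain ⟨h', rfl⟩ := hdvd
      exact ⟨h', mul_right_cancel₀ (b := single γ d) (by simpa using hd) (by rw [hbh]; ring)⟩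
    have hlocal : ∀ Q : Ideal (AddMonoidAlgebra D Γ), IsHeightOne Q →
        ∃ s ∉ Q, single γ d ∣ s * h := fun Q hQ ↦ by
      obtain ⟨s, hs, r, hr⟩ := hab Q hQ
      exact ⟨s, hs, r, mul_left_cancel₀ ha (by linear_combination (-s) * hbh + single γ d * hr)⟩
    refine single_dvd_of_forall fun δ hδ ↦ ⟨?_, ?_⟩
    · refine hΓ1 γ δ fun S hS ↦ ?_
      obtain ⟨s, hs, hdvd⟩ := hlocal _ (hSht S hS)
      have := hS.mem_exponentIdeal_of_mul_mem (α := γ) hs (f := h) (mem_exponentIdeal.2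
        fun ξ hξ ↦ by
          obtain ⟨c, hc⟩ := (of_single_dvd hdvd ξ hξ).1
          exact ⟨0, hS.isPrimeIdeal.zero_notMem, c, by rw [zero_add, hc]⟩)
      exact mem_exponentIdeal.1 this δ hδ
    · refine hD1 d _ hd fun P hP ↦ ?_
      by_cases hdP : d ∈ P
      swap
      · exact ⟨d, hdP, dvd_mul_right _ _⟩
      obtain ⟨s, hs, hdvd⟩ := hlocal _ (hPht P hP)
      exact (hP.isMinimalOver hdP hd).mem_coeffIdeal_of_mul_mem hP.isPrime hs (f := h)
        (fun ξ ↦ by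
          by_cases h0 : (s * h).coeff ξ = 0
          · rw [h0]
            exact zero_mem _
          · exact ⟨1, hP.isPrime.one_notMem, by
              rw [one_mul]
              exact (of_single_dvd hdvd ξ h0).2⟩) δ
  -- A height-one prime containing `f` comes from `K[G]`, unless it contains a monomial; a single
  -- exponent `γ` of `f` then leaves only finitely many `P[Γ]` and `D[S]`.
  · have hφf : toGroupRing D Γ K f ≠ 0 := fun h ↦ hf (hinj (by rw [h, map_zero]))
    obtain ⟨γ, hγ⟩ := Finsupp.support_nonempty_iff.2
      (show f.coeff ≠ 0 by simpa using hf)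
    rw [Finsupp.mem_support_iff] at hγ
    refine ((((hK2 _ hφf).image (Ideal.comap (algebraMap (AddMonoidAlgebra D Γ)
      (AddMonoidAlgebra K (GrothendieckAddGroup Γ))))).union
      ((hD2 _ hγ).image (coeffIdeal Γ))).union ((hΓ2 γ).image (exponentIdeal D))).subset ?_
    rintro Q ⟨hQ, hfQ⟩
    by_cases hdis : Disjoint (monomials D Γ : Set (AddMonoidAlgebra D Γ)) Q
    · obtain ⟨hQ', hc⟩ := hQ.map_of_isLocalization (monomials D Γ)
        (AddMonoidAlgebra K (GrothendieckAddGroup Γ)) hdis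
      exact .inl (.inl ⟨_, ⟨hQ', Ideal.mem_map_of_mem _ hfQ⟩, hc⟩)
    · obtain ⟨_, ⟨δ, d, hd, rfl⟩, hmem⟩ := Set.not_disjoint_iff.1 hdis
      have hmul : single δ 1 * single 0 d ∈ Q := by
        rw [single_mul_single, add_zero, one_mul]
        exact hmem
      rcases hQ.isPrime.mem_or_mem hmul with h | h
      · obtain ⟨S, hS, rfl⟩ := hQ.exists_eq_exponentIdeal h
        exact .inr ⟨S, ⟨hS, mem_exponentIdeal.1 hfQ γ hγ⟩, rfl⟩
      · obtain ⟨P, hP, rfl⟩ := hQ.exists_eq_coeffIdeal hd h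
        exact .inl (.inr ⟨P, ⟨hP, hfQ γ⟩, rfl⟩)

end Ascent

/-! ### Restriction to cosets of a cyclic subgroup -/

section Descent

open AddMonoidAlgebra
open Algebra (GrothendieckAddGroup)

variable {D Γ : Type*} [CommRing D] [AddCommMonoid Γ]

/-- The substitution `X ↦ X ^ γ`, as a homomorphism `D[X] → D[Γ]`. -/
noncomputable def substMonomial (D : Type*) [CommRing D] (γ : Γ) :
    Polynomial D →+* AddMonoidAlgebra D Γ :=
  (mapDomainRingHom D (multiplesHom Γ γ)).comp (Polynomial.toFinsuppIso D : _ →+* _)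

lemma substMonomial_monomial (γ : Γ) (n : ℕ) (d : D) :
    substMonomial D γ (Polynomial.monomial n d) = single (n • γ) d := by
  simp [substMonomial]

variable [IsCancelAdd Γ] [IsAddTorsionFree Γ]

lemma zsmul_of_injective {γ : Γ} (hγ : γ ≠ 0) :
    Function.Injective fun n : ℤ ↦ n • GrothendieckAddGroup.of γ := fun m n h ↦ by
  have h0 : GrothendieckAddGroup.of γ ≠ 0 := fun h ↦ hγ
    (GrothendieckAddGroup.of_injective (h.trans (map_zero _).symm))
  have h' : (m - n) • GrothendieckAddGroup.of γ = 0 := by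
    rw [sub_smul]
    exact sub_eq_zero.2 h
  exact sub_eq_zero.1 ((IsAddTorsionFree.zsmul_eq_zero_iff_left h0).1 h')

lemma substMonomial_injective {γ : Γ} (hγ : γ ≠ 0) :
    Function.Injective (substMonomial D γ) :=
  (mapDomain_injective (f := multiplesHom Γ γ) fun m n h ↦ by
    have h' := congrArg GrothendieckAddGroup.of h
    simp only [multiplesHom_apply, map_nsmul] at h'
    exact Nat.cast_injective (zsmul_of_injective hγ (by simpa only [natCast_zsmul] using h'))).comp
    (Polynomial.toFinsuppIso D).injective

/-- The part of `h` supported on the coset `α + ℤγ`, read as a Laurent polynomial in `X ^ γ`. -/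
noncomputable def cosetPart {γ : Γ} (hγ : γ ≠ 0) (α : Γ) (h : AddMonoidAlgebra D Γ) :
    LaurentPolynomial D :=
  comapDomain (fun n : ℤ ↦ GrothendieckAddGroup.of α + n • GrothendieckAddGroup.of γ)
    (fun _ _ h ↦ zsmul_of_injective hγ (add_left_cancel h))
    (mapDomainRingHom D (GrothendieckAddGroup.of (M := Γ)) h)

lemma coeff_cosetPart {γ : Γ} (hγ : γ ≠ 0) (α : Γ) (h : AddMonoidAlgebra D Γ) (n : ℤ) :
    (cosetPart hγ α h).coeff n = (mapDomainRingHom D (GrothendieckAddGroup.of (M := Γ)) h).coeff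
      (GrothendieckAddGroup.of α + n • GrothendieckAddGroup.of γ) := by
  simp [cosetPart]

lemma coeff_cosetPart_zero {γ : Γ} (hγ : γ ≠ 0) (α : Γ) (h : AddMonoidAlgebra D Γ) :
    (cosetPart hγ α h).coeff 0 = h.coeff α := by
  rw [coeff_cosetPart, zero_smul, add_zero]
  exact Finsupp.mapDomain_apply GrothendieckAddGroup.of_injective _ _

/-- Taking the part supported on a coset of `ℤγ` is linear over the polynomials in `X ^ γ`. -/
lemma cosetPart_substMonomial_mul {γ : Γ} (hγ : γ ≠ 0) (α : Γ) (f : Polynomial D)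
    (h : AddMonoidAlgebra D Γ) :
    cosetPart hγ α (substMonomial D γ f * h) = f.toLaurent * cosetPart hγ α h := by
  induction f using Polynomial.induction_on' with
  | add p q hp hq =>
    rw [map_add, add_mul, map_add, add_mul, ← hp, ← hq]
    ext n
    simp only [coeff_cosetPart, coeff_add, Finsupp.add_apply, map_add]
  | monomial k d =>
    have hk : (Polynomial.monomial k d).toLaurent = (single (k : ℤ) d : LaurentPolynomial D) := by
      rw [← Polynomial.C_mul_X_pow_eq_monomial, Polynomial.toLaurent_C_mul_X_pow,
        LaurentPolynomial.single_eq_C_mul_T]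
    ext n
    have hof : mapDomainRingHom D (GrothendieckAddGroup.of (M := Γ)) (single (k • γ) d) =
        single (k • GrothendieckAddGroup.of γ) d := by
      rw [← map_nsmul]
      exact mapDomain_single ..
    rw [hk, coeff_single_mul_apply, coeff_cosetPart, coeff_cosetPart, substMonomial_monomial,
      map_mul, hof, coeff_single_mul_apply]
    congr 2
    rw [add_smul, neg_smul, natCast_zsmul]
    abel

variable [IsDomain D]

/-! ### Descent of the weak Krull property -/

lemma IsHeightOne.isHeightOne_coeffIdeal_of_isWeaklyKrullDomain
    (hR : IsWeaklyKrullDomain (AddMonoidAlgebra D Γ)) {P : Ideal D} (hP : IsHeightOne P) :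
    IsHeightOne (coeffIdeal Γ P) := by
  obtain ⟨a, ha, ha0⟩ := hP.exists_ne_zero
  exact ((hP.isMinimalOver ha ha0).isMinimalOver_coeffIdeal hP.isPrime).isHeightOne hR
    (isPrime_coeffIdeal hP.isPrime)

lemma IsHeightOnePrime.isHeightOne_exponentIdeal_of_isWeaklyKrullDomain
    (hR : IsWeaklyKrullDomain (AddMonoidAlgebra D Γ)) {S : AddSemigroupIdeal Γ}
    (hS : IsHeightOnePrime S) : IsHeightOne (exponentIdeal D S) := by
  obtain ⟨α, hα⟩ := hS.prop.2
  exact (hS.isMinimalOver_exponentIdeal hα).isHeightOne hR (isPrime_exponentIdeal hS.isPrimeIdeal)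

theorem isWeaklyKrullDomain_coefficients (hR : IsWeaklyKrullDomain (AddMonoidAlgebra D Γ)) :
    IsWeaklyKrullDomain D := by
  obtain ⟨h1, h2⟩ := isWeaklyKrullDomain_iff.1 hR
  refine isWeaklyKrullDomain_iff.2 ⟨fun a b ha hab ↦ ?_, fun a ha ↦ ?_⟩
  · have hdvd : (single 0 a : AddMonoidAlgebra D Γ) ∣ single 0 b := by
      refine h1 _ _ (by simpa using ha) fun Q hQ ↦ ?_
      by_cases haQ : single 0 a ∈ Q
      swap
      · exact ⟨_, haQ, dvd_mul_right _ _⟩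
      obtain ⟨P, hP, rfl⟩ := hQ.exists_eq_coeffIdeal ha haQ
      obtain ⟨s, hs, c, hc⟩ := hab P hP
      exact ⟨single 0 s, fun h ↦ hs (single_mem_coeffIdeal.1 h), single 0 c, by
        rw [single_mul_single, single_mul_single, hc]⟩
    by_cases hb : b = 0
    · rw [hb]
      exact dvd_zero a
    · simpa using (of_single_dvd hdvd 0 (by simpa using hb)).2
  · refine Set.Finite.of_finite_image ((h2 (single 0 a) (by simpa using ha)).subset ?_)
      (f := coeffIdeal Γ) coeffIdeal_injective.injOn
    rintro _ ⟨P, ⟨hP, haP⟩, rfl⟩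
    exact ⟨hP.isHeightOne_coeffIdeal_of_isWeaklyKrullDomain hR, single_mem_coeffIdeal.2 haP⟩

theorem isWeaklyKrullMonoid_exponents (hR : IsWeaklyKrullDomain (AddMonoidAlgebra D Γ)) :
    IsWeaklyKrullMonoid Γ := by
  obtain ⟨h1, h2⟩ := isWeaklyKrullDomain_iff.1 hR
  refine isWeaklyKrullMonoid_iff.2 ⟨fun a b hab ↦ ?_, fun a ↦ ?_⟩
  · have hdvd : (single a 1 : AddMonoidAlgebra D Γ) ∣ single b 1 := by
      refine h1 _ _ (by simp) fun Q hQ ↦ ?_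
      by_cases haQ : single a 1 ∈ Q
      swap
      · exact ⟨_, haQ, dvd_mul_right _ _⟩
      obtain ⟨S, hS, rfl⟩ := hQ.exists_eq_exponentIdeal haQ
      obtain ⟨t, ht, c, hc⟩ := hab S hS
      exact ⟨single t 1, fun h ↦ ht ((single_mem_exponentIdeal one_ne_zero).1 h), single c 1, by
        rw [single_mul_single, single_mul_single, hc]⟩
    exact (of_single_dvd hdvd b (by simp)).1
  · refine Set.Finite.of_finite_image ((h2 (single a 1) (by simp)).subset ?_)
      (f := exponentIdeal D) exponentIdeal_injective.injOn
    rintro _ ⟨S, ⟨hS, haS⟩, rfl⟩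
    exact ⟨hS.isHeightOne_exponentIdeal_of_isWeaklyKrullDomain hR,
      (single_mem_exponentIdeal one_ne_zero).2 haS⟩

theorem isWeaklyKrullDomain_groupRing (K : Type*) [Field K] [Algebra D K] [IsFractionRing D K]
    (hR : IsWeaklyKrullDomain (AddMonoidAlgebra D Γ)) :
    IsWeaklyKrullDomain (AddMonoidAlgebra K (GrothendieckAddGroup Γ)) := by
  let _ := (toGroupRing D Γ K).toAlgebra
  have hloc := isLocalization_toGroupRing (D := D) (Γ := Γ) K
  refine hR.of_isLocalization (monomials D Γ) ?_ _
  rintro _ ⟨γ, d, hd, rfl⟩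
  exact mem_nonZeroDivisors_of_ne_zero (by simpa using hd)

/-! ### Descent of the UMT property to the coefficients -/

/-- If an upper to zero `Q` were contained in `P[X]`, then for `f ∈ Q` nonzero the substitution
`X ↦ X ^ γ` would give an element of the height-one prime `P[Γ]`, so that it divides
`s * d ^ m` for some `s ∉ P[Γ]` and some constant `d`. Restricting to a coset of `ℤγ` on which `s`
has a coefficient outside `P`, one obtains the same in `D[X]`, with `s` in `Q`. -/
theorem isUMTDomain_coefficients [Nontrivial Γ] (hR : IsWeaklyKrullDomain (AddMonoidAlgebra D Γ)) :
    IsUMTDomain D := by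
  refine (isUMTDomain_iff (isWeaklyKrullDomain_coefficients hR)).2 fun Q hQ hQ0 hQD P hP hle ↦ ?_
  obtain ⟨γ, hγ⟩ := exists_ne (0 : Γ)
  obtain ⟨f, hfQ, hf⟩ := Submodule.exists_mem_ne_zero_of_ne_bot hQ0
  obtain ⟨d, hdP, hd⟩ := hP.exists_ne_zero
  have hfP : substMonomial D γ f ∈ coeffIdeal Γ P := by
    have : P.map Polynomial.C ≤ (coeffIdeal Γ P).comap (substMonomial D γ) :=
      Ideal.map_le_iff_le_comap.2 fun x hx ↦ by
        rw [Ideal.mem_comap, Ideal.mem_comap, ← Polynomial.monomial_zero_left,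
          substMonomial_monomial]
        exact single_mem_coeffIdeal.2 hx
    exact this (hle hfQ)
  have hf0 : substMonomial D γ f ≠ 0 := fun h ↦
    hf (substMonomial_injective hγ (h.trans (map_zero _).symm))
  obtain ⟨s, hs, m, r, hr⟩ := ((hP.isHeightOne_coeffIdeal_of_isWeaklyKrullDomain hR).isMinimalOver
    hfP hf0).2.2 (single 0 d) (single_mem_coeffIdeal.2 hdP)
  obtain ⟨α, hα⟩ := not_forall.1 hs
  have hconst : (single 0 d : AddMonoidAlgebra D Γ) ^ m =
      substMonomial D γ (Polynomial.C (d ^ m)) := by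
    rw [single_pow, smul_zero, ← Polynomial.monomial_zero_left, substMonomial_monomial, zero_smul]
  rw [hconst, mul_comm] at hr
  have hpart := congrArg (cosetPart hγ α) hr
  rw [cosetPart_substMonomial_mul, cosetPart_substMonomial_mul] at hpart
  -- Multiplication by powers of `X` turns the Laurent polynomials into polynomials.
  obtain ⟨M, s', hs'⟩ := (cosetPart hγ α s).exists_T_pow
  obtain ⟨N, r', hr'⟩ := (cosetPart hγ α r).exists_T_pow
  have hpoly : Polynomial.C (d ^ m) * (s' * Polynomial.X ^ N) = f * (r' * Polynomial.X ^ M) := by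
    refine Polynomial.toLaurent_injective ?_
    simp only [map_mul, Polynomial.toLaurent_X_pow, hs', hr']
    linear_combination (LaurentPolynomial.T M * LaurentPolynomial.T N) * hpart
  have hmem : s' * Polynomial.X ^ N ∈ Q := by
    refine (hQ.mem_or_mem (hpoly ▸ Ideal.mul_mem_right _ _ hfQ)).resolve_left fun h ↦ ?_
    have : d ^ m ∈ Q.comap Polynomial.C := h
    rw [hQD, Ideal.mem_bot] at this
    exact pow_ne_zero m hd this
  have hcoeff := Ideal.mem_map_C_iff.1 (hle hmem) (M + N)
  rw [Polynomial.coeff_mul_X_pow] at hcoeff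
  have hval : s'.coeff M = s.coeff α := by
    have h1 : (Polynomial.toLaurent s').coeff (M : ℤ) = s'.coeff M := by
      rw [Polynomial.toLaurent_apply]
      exact Finsupp.mapDomain_apply Nat.cast_injective _ _
    rw [← h1, hs', mul_comm, LaurentPolynomial.T, coeff_single_mul_apply, one_mul,
      neg_add_cancel, coeff_cosetPart_zero]
  exact hα (hval ▸ hcoeff)

/-! ### Descent of the UMT property to the exponents -/

/-- For `α` and `β` in a height-one prime `S`, the binomial `X ^ α - X ^ β` divides
`σ * X ^ (m • α)` for some `σ ∉ D[S]`. Two exponents of `σ` are therefore congruent modulo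
`α - β`. -/
theorem isUMTMonoid_exponents (hR : IsWeaklyKrullDomain (AddMonoidAlgebra D Γ)) :
    IsUMTMonoid Γ := by
  intro S hmax
  have hS := (isMaximalMonoidTIdeal_iff (isWeaklyKrullMonoid_exponents hR)).1 hmax
  have hSp := hS.isPrimeIdeal
  refine (isValuationMonoid_localizationAt_iff hSp).2 fun g ↦ ?_
  obtain ⟨α, β, rfl⟩ := exists_eq_of_sub_of g
  by_cases hβ : β ∈ S
  swap
  · exact .inl ((mem_localizationAt_rootClosure hSp).2 ⟨1, le_rfl, α, β, hβ, one_smul _ _⟩)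
  by_cases hα : α ∈ S
  swap
  · exact .inr ((mem_localizationAt_rootClosure hSp).2 ⟨1, le_rfl, β, α, hα, by
      rw [one_smul, neg_sub]⟩)
  by_cases hαβ : α = β
  · exact .inl ((mem_localizationAt_rootClosure hSp).2 ⟨1, le_rfl, 0, 0, hSp.zero_notMem, by
      simp [hαβ]⟩)
  have hαS := (single_mem_exponentIdeal (D := D) one_ne_zero).2 hα
  have hβS := (single_mem_exponentIdeal (D := D) one_ne_zero).2 hβ
  have hne : (single α 1 - single β 1 : AddMonoidAlgebra D Γ) ≠ 0 := fun h ↦ hαβ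
    (single_left_injective one_ne_zero (sub_eq_zero.1 h))
  obtain ⟨σ, hσ, m, hdvd⟩ := ((hS.isHeightOne_exponentIdeal_of_isWeaklyKrullDomain
    hR).isMinimalOver (Ideal.sub_mem _ hαS hβS) hne).2.2 _ hαS
  set g := GrothendieckAddGroup.of α - GrothendieckAddGroup.of β with hg
  -- In `D[G / ℤg]` the binomial vanishes and `X ^ α` becomes a unit, so that `σ` vanishes.
  let q : Γ →+ GrothendieckAddGroup Γ ⧸ AddSubgroup.zmultiples g :=
    (QuotientAddGroup.mk' _).comp GrothendieckAddGroup.of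
  have hq : ∀ γ δ, q γ = q δ →
      ∃ n : ℤ, n • g = GrothendieckAddGroup.of δ - GrothendieckAddGroup.of γ := fun γ δ h ↦ by
    obtain ⟨n, hn⟩ := AddSubgroup.mem_zmultiples_iff.1 (QuotientAddGroup.eq.1 h)
    exact ⟨n, hn.trans (by abel)⟩
  have hqαβ : q α = q β := QuotientAddGroup.eq.2
    (AddSubgroup.mem_zmultiples_iff.2 ⟨-1, by rw [hg, neg_one_smul]; abel⟩)
  have hqσ : mapDomainRingHom D q σ = 0 := by
    obtain ⟨r, hr⟩ := hdvd
    have := congrArg (mapDomainRingHom D q) hr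
    have hs : ∀ γ, mapDomainRingHom D q (single γ (1 : D)) = single (q γ) 1 :=
      fun γ ↦ mapDomain_single ..
    rw [map_mul, map_mul, map_sub, map_pow, hs, hs, hqαβ, sub_self, zero_mul, single_pow,
      one_pow] at this
    have hu : single (m • q β) (1 : D) * single (-(m • q β)) 1 = 1 := by
      rw [single_mul_single, add_neg_cancel, one_mul]
      rfl
    rw [← mul_one (mapDomainRingHom D q σ), ← hu, ← mul_assoc, this, zero_mul]
  obtain ⟨τ, hτ0, hτS⟩ : ∃ τ, σ.coeff τ ≠ 0 ∧ τ ∉ S := by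
    by_contra! hcon
    exact hσ (mem_exponentIdeal.2 hcon)
  -- The coefficient of the vanishing element at the class of `τ` is a sum with a nonzero term.
  obtain ⟨δ, hδτ, hqδ⟩ : ∃ δ, δ ≠ τ ∧ q τ = q δ := by
    by_contra! hcon
    refine hτ0 ?_
    have h0 : (mapDomainRingHom D q σ).coeff (q τ) = 0 := by rw [hqσ]; rfl
    refine Eq.trans ?_ h0
    classical
    change _ = Finsupp.mapDomain q σ.coeff (q τ)
    rw [Finsupp.mapDomain_apply_eq_sum]
    refine (Finset.sum_eq_single τ (fun δ hδ hne ↦ ?_) fun hτ ↦ ?_).symm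
    · exact absurd (Finset.mem_filter.1 hδ).2.symm (hcon δ hne)
    · simpa using hτ
  obtain ⟨n, hn⟩ := hq τ δ hqδ
  have hn0 : n ≠ 0 := by
    rintro rfl
    rw [zero_smul, eq_comm, sub_eq_zero] at hn
    exact hδτ (GrothendieckAddGroup.of_injective hn)
  obtain ⟨k, rfl | rfl⟩ := n.eq_nat_or_neg
  · exact .inl ((mem_localizationAt_rootClosure hSp).2 ⟨k, by omega, δ, τ, hτS, by simpa using hn⟩)
  · exact .inr ((mem_localizationAt_rootClosure hSp).2 ⟨k, by omega, δ, τ, hτS, by simpa using hn⟩)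

end Descent

end WeaklyKrull

theorem mainTheorem1 {D : Type*} [CommRing D] [IsDomain D]
    {K : Type*} [Field K] [Algebra D K] [IsFractionRing D K]
    {Γ : Type*} [AddCommMonoid Γ] [IsCancelAdd Γ] [IsAddTorsionFree Γ] [Nontrivial Γ] :
    WeaklyKrull.IsWeaklyKrullDomain (AddMonoidAlgebra D Γ) ↔
      (WeaklyKrull.IsWeaklyKrullDomain D ∧ WeaklyKrull.IsUMTDomain D) ∧
      (WeaklyKrull.IsWeaklyKrullMonoid Γ ∧ WeaklyKrull.IsUMTMonoid Γ) ∧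
      WeaklyKrull.IsWeaklyKrullDomain
        (AddMonoidAlgebra K (Algebra.GrothendieckAddGroup Γ)) :=
  ⟨fun hR ↦ ⟨⟨WeaklyKrull.isWeaklyKrullDomain_coefficients hR,
      WeaklyKrull.isUMTDomain_coefficients hR⟩,
    ⟨WeaklyKrull.isWeaklyKrullMonoid_exponents hR, WeaklyKrull.isUMTMonoid_exponents hR⟩,
    WeaklyKrull.isWeaklyKrullDomain_groupRing K hR⟩,
   fun ⟨⟨hD, hDt⟩, ⟨hΓ, hΓt⟩, hK⟩ ↦
    WeaklyKrull.isWeaklyKrullDomain_addMonoidAlgebra hD hDt hΓ hΓt hK⟩
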